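/- Let $W=\langle S\mid (st)^{m_{st}}=1\rangle$ be an infinite right-angled Coxeter group with finite generating set $S$ (so $m_{ss}=1$ and $m_{st}\in\{2,\infty\}$ for $s\neq t$), and let $L$ be the nerve of $(W,S)$: the simplicial complex with vertex set $S$ in which a nonempty set $T\subseteq S$ spans a simplex if and only if the subgroup $W_T=\langle T\rangle$ is finite. Call $L$ rigid if the only automorphism of $L$ that fixes pointwise the star of some vertex of $L$ is the identity, and flexible otherwise. Let $X$ be a regular building of type $(W,S)$ with (finite integer) parameters $\{q_s\}_{s\in S}$, that is, for each $s\in S$ every $s$-equivalence class of chambers has exactly $q_s\geq 2$ elements. Regard $X$ as a locally finite complex through its standard geometric realization, in which each chamber is a copy of the geometric realization of the poset of subsets $T\subseteq S$ with $W_T$ finite; the vertices of $X$ of type $T$ correspond to the $T$-residues of chambers. Let $G=\operatorname{Aut}(X)$ be the group of cellular automorphisms of $X$ (mapping chambers to chambers, not necessarily preserving types), with the compact-open topology, and let $G_0=\operatorname{Aut}_0(X)\leq G$ be the subgroup of type-preserving automorphisms. 1. If there are $s,t\in S$ such that $q_s>2$ and $m_{st}=\infty$, then $G_0$ and $G$ are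 both nondiscrete. 2. If $q_s=2$ for all $s\in S$, then $G_0$ is discrete, and $G$ is nondiscrete if and only if $L$ is flexible. 3. If there is some $t \in S$ with $q_t>2$, and for every $t\in S$ with $q_t>2$ we have $m_{st}=2$ for all $s\in S\setminus\{t\}$, then $G_0$ is discrete, and $G$ is nondiscrete if and only if $L$ is flexible. -/

import Mathlib

/-! ### Right-angled Coxeter systems, spherical subsets, nerves

In Mathlib a Coxeter matrix `M` has natural number entries, and the entry `0` encodes `∞`. -/

/-- A Coxeter matrix is right-angled if `M s t ∈ {2, ∞}` for all `s ≠ t`. -/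
def CoxeterMatrix.IsRightAngled {S : Type*} (M : CoxeterMatrix S) : Prop :=
  ∀ s t, s ≠ t → M s t = 2 ∨ M s t = 0

/-- The special subgroup `W_T`, generated by the elements of `T ⊆ S`. -/
def CoxeterSystem.specialSubgroup {S W : Type*} [Group W] {M : CoxeterMatrix S}
    (cs : CoxeterSystem M W) (T : Set S) : Subgroup W :=
  Subgroup.closure (cs.simple '' T)

/-- A set `T` of generators is spherical if `W_T` is finite. -/
def CoxeterSystem.IsSpherical {S W : Type*} [Group W] {M : CoxeterMatrix S}
    (cs : CoxeterSystem M W) (T : Set S) : Prop :=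
  Finite (cs.specialSubgroup T)

theorem CoxeterSystem.IsSpherical.mono {S W : Type*} [Group W] {M : CoxeterMatrix S}
    {cs : CoxeterSystem M W} {T T' : Set S} (h : cs.IsSpherical T) (hT : T' ⊆ T) :
    cs.IsSpherical T' := by
  have h' : Finite (cs.specialSubgroup T) := h
  have hle : cs.specialSubgroup T' ≤ cs.specialSubgroup T :=
    Subgroup.closure_mono (Set.image_mono hT)
  exact Finite.of_injective _ (Subgroup.inclusion_injective hle)

theorem CoxeterSystem.isSpherical_singleton {S W : Type*} [Group W] {M : CoxeterMatrix S}
    (cs : CoxeterSystem M W) (s : S) : cs.IsSpherical {s} := by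
  have h : IsOfFinOrder (cs.simple s) :=
    isOfFinOrder_iff_pow_eq_one.2 ⟨2, by norm_num, cs.simple_sq s⟩
  unfold CoxeterSystem.IsSpherical CoxeterSystem.specialSubgroup
  rw [Set.image_singleton, ← Subgroup.zpowers_eq_closure]
  exact (finite_zpowers.2 h).to_subtype

/-- The nerve `L` of a Coxeter system: the abstract simplicial complex with vertex set `S` whose
simplices are the nonempty spherical subsets. -/
def CoxeterSystem.nerve {S W : Type*} [Group W] {M : CoxeterMatrix S}
    (cs : CoxeterSystem M W) : AbstractSimplicialComplex S where
  faces := {T : Finset S | T.Nonempty ∧ cs.IsSpherical (T : Set S)}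
  isRelLowerSet_faces := fun _ hT =>
    ⟨hT.1, fun _ hle hne => ⟨hne, hT.2.mono (Finset.coe_subset.2 hle)⟩⟩
  singleton_mem := fun s =>
    ⟨Finset.singleton_nonempty s, by
      rw [Finset.coe_singleton]; exact cs.isSpherical_singleton s⟩

/-- A permutation of the vertex set is an automorphism of the simplicial complex `L` if it maps
the simplices of `L` bijectively to the simplices of `L`. -/
def AbstractSimplicialComplex.IsAutomorphism {V : Type*} (L : AbstractSimplicialComplex V)
    (g : Equiv.Perm V) : Prop :=
  ∀ T : Finset V, T.map g.toEmbedding ∈ L.faces ↔ T ∈ L.faces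

/-- The vertices of the (closed) star of `v` in `L`: the vertices of the simplices that
contain `v`. -/
def AbstractSimplicialComplex.starVertices {V : Type*} (L : AbstractSimplicialComplex V)
    (v : V) : Set V :=
  {w | ∃ T ∈ L.faces, v ∈ T ∧ w ∈ T}

/-- `L` is rigid if the only automorphism fixing (pointwise) the star of some vertex is the
identity. -/
def AbstractSimplicialComplex.IsRigid {V : Type*} (L : AbstractSimplicialComplex V) : Prop :=
  ∀ g : Equiv.Perm V, L.IsAutomorphism g → ∀ v : V, (∀ w ∈ L.starVertices v, g w = w) → g = 1

/-- `L` is flexible if it is not rigid. -/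
def AbstractSimplicialComplex.IsFlexible {V : Type*} (L : AbstractSimplicialComplex V) : Prop :=
  ¬ L.IsRigid

/-! ### Chamber systems and buildings -/

/-- A chamber system over `S` with set of chambers `Φ`: a family of equivalence relations. -/
structure ChamberSystem (S Φ : Type*) where
  /-- `s`-equivalence -/
  equivalence : S → Setoid Φ

namespace ChamberSystem

/-- Two chambers are `s`-adjacent if they are `s`-equivalent and distinct. -/
def Adjacent {S Φ : Type*} (C : ChamberSystem S Φ) (s : S) (φ ψ : Φ) : Prop :=
  (C.equivalence s).r φ ψ ∧ φ ≠ ψ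

/-- `C.HasGallery φ ψ w`: there is a gallery of type `w` from `φ` to `ψ`. -/
inductive HasGallery {S Φ : Type*} (C : ChamberSystem S Φ) : Φ → Φ → List S → Prop
  | nil (φ : Φ) : HasGallery C φ φ []
  | cons {φ χ ψ : Φ} {s : S} {w : List S} :
      C.Adjacent s φ χ → HasGallery C χ ψ w → HasGallery C φ ψ (s :: w)

/-- `C` is a building of type `(W, S)`: every `s`-equivalence class has at least two chambers, and
there is a `W`-valued distance function. -/
def IsBuilding {S Φ W : Type*} [Group W] {M : CoxeterMatrix S} (C : ChamberSystem S Φ)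
    (cs : CoxeterSystem M W) : Prop :=
  (∀ (s : S) (φ : Φ), ∃ ψ, C.Adjacent s φ ψ) ∧
  ∃ δ : Φ → Φ → W, ∀ w : List S, cs.IsReduced w → ∀ φ ψ : Φ,
    C.HasGallery φ ψ w ↔ δ φ ψ = cs.wordProd w

/-- Every `s`-equivalence class of chambers has exactly `q s` elements (in particular it is
finite). -/
def HasParameters {S Φ : Type*} (C : ChamberSystem S Φ) (q : S → ℕ) : Prop :=
  ∀ (s : S) (φ : Φ), {ψ | (C.equivalence s).r φ ψ}.encard = (q s : ℕ∞)

/-- The `T`-residue of `φ`: the chambers joined to `φ` by a gallery whose type is a word in `T`. -/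
def residue {S Φ : Type*} (C : ChamberSystem S Φ) (T : Set S) (φ : Φ) : Set Φ :=
  {ψ | ∃ w : List S, (∀ s ∈ w, s ∈ T) ∧ C.HasGallery φ ψ w}

/-! ### The geometric realization

The geometric realization `X` is a simplicial complex obtained by gluing copies of the chamber `K`,
one for each `φ : Φ`; here `K` is the geometric realization of the poset of spherical subsets.
The vertices of type `T` of the copies of `K` belonging to `φ` and `ψ` are identified if and only
if `φ` and `ψ` lie in the same `T`-residue.  So the vertices of `X` are the residues of
spherical type, and the simplices of `X` are the finite nonempty chains of such residues. -/

/-- A vertex of `X`: a spherical subset `T` (its type), together with a `T`-residue. -/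
@[ext]
structure Vertex {S Φ W : Type*} [Group W] {M : CoxeterMatrix S} (C : ChamberSystem S Φ)
    (cs : CoxeterSystem M W) where
  /-- the type of the vertex -/
  type : Set S
  /-- the set of chambers that contain the vertex -/
  chambers : Set Φ
  isSpherical : cs.IsSpherical type
  isResidue : ∃ φ, chambers = C.residue type φ

instance {S Φ W : Type*} [Group W] {M : CoxeterMatrix S} (C : ChamberSystem S Φ)
    (cs : CoxeterSystem M W) : PartialOrder (C.Vertex cs) :=
  PartialOrder.lift (fun v => (v.type, v.chambers)) fun _ _ h =>
    Vertex.ext (congrArg Prod.fst h) (congrArg Prod.snd h)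

/-- The set of vertices of the chamber of `X` that corresponds to `φ : Φ`. -/
def chamberVertices {S Φ W : Type*} [Group W] {M : CoxeterMatrix S} (C : ChamberSystem S Φ)
    (cs : CoxeterSystem M W) (φ : Φ) : Set (C.Vertex cs) :=
  {v | φ ∈ v.chambers}

end ChamberSystem

/-- The geometric realization of (the order complex of) a poset `P`: the space of barycentric
coordinates supported on finite chains.  It carries the topology of pointwise convergence of
barycentric coordinates; for a locally finite complex this is the usual (weak = metric) topology. -/
def OrderRealization (P : Type*) [PartialOrder P] : Type _ :=
  {x : P → ℝ // (∀ v, 0 ≤ x v) ∧ (Function.support x).Finite ∧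
    IsChain (· ≤ ·) (Function.support x) ∧ ∑ᶠ v, x v = 1}

instance (P : Type*) [PartialOrder P] : TopologicalSpace (OrderRealization P) :=
  inferInstanceAs (TopologicalSpace (Subtype _))

namespace ChamberSystem

/-- The geometric realization `X` of a building. -/
abbrev Realization {S Φ W : Type*} [Group W] {M : CoxeterMatrix S} (C : ChamberSystem S Φ)
    (cs : CoxeterSystem M W) : Type _ :=
  OrderRealization (C.Vertex cs)

/-! ### Automorphisms -/

/-- The group `G = Aut(X)` of automorphisms of the building `X`, not necessarily type-preserving,
as a group of permutations of the vertices of `X`: the simplicial automorphisms (two vertices span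
an edge if and only if their images do) that map chambers to chambers. -/
def autGroup {S Φ W : Type*} [Group W] {M : CoxeterMatrix S} (C : ChamberSystem S Φ)
    (cs : CoxeterSystem M W) : Subgroup (Equiv.Perm (C.Vertex cs)) where
  carrier := {g | (∀ v w, (g v ≤ g w ∨ g w ≤ g v) ↔ (v ≤ w ∨ w ≤ v)) ∧
    ∀ A : Set (C.Vertex cs),
      (∃ φ, g '' A = C.chamberVertices cs φ) ↔ (∃ φ, A = C.chamberVertices cs φ)}
  one_mem' := ⟨fun _ _ => Iff.rfl, fun A => by simp⟩
  mul_mem' := by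
    rintro g h ⟨hg, hg'⟩ ⟨hh, hh'⟩
    refine ⟨fun v w => (hg _ _).trans (hh v w), fun A => ?_⟩
    have : (⇑(g * h)) '' A = g '' (h '' A) := by
      rw [Equiv.Perm.coe_mul, Set.image_comp]
    rw [this, hg', hh']
  inv_mem' := by
    rintro g ⟨hg, hg'⟩
    refine ⟨fun v w => ?_, fun A => ?_⟩
    · have := hg (g⁻¹ v) (g⁻¹ w)
      simpa using this.symm
    · have := hg' ((⇑g⁻¹) '' A)
      rw [← Set.image_comp, ← Equiv.Perm.coe_mul, mul_inv_cancel, Equiv.Perm.coe_one,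
        Set.image_id] at this
      exact this.symm

/-- `G = Aut(X)` -/
abbrev Aut {S Φ W : Type*} [Group W] {M : CoxeterMatrix S} (C : ChamberSystem S Φ)
    (cs : CoxeterSystem M W) : Type _ :=
  C.autGroup cs

/-- An automorphism acts on `X` by the homeomorphism that is affine on every simplex:
`∑ x_v v ↦ ∑ x_v g(v)`. -/
def Aut.toContinuousMap {S Φ W : Type*} [Group W] {M : CoxeterMatrix S} {C : ChamberSystem S Φ}
    {cs : CoxeterSystem M W} (g : C.Aut cs) : C(C.Realization cs, C.Realization cs) where
  toFun x := ⟨fun v => x.1 (g.1.symm v), by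
    obtain ⟨x, h0, hfin, hch, hsum⟩ := x
    refine ⟨fun v => h0 _, ?_, ?_, ?_⟩
    · exact hfin.preimage g.1.symm.injective.injOn
    · intro v hv w hw hvw
      have := hch hv hw (g.1.symm.injective.ne hvw)
      simpa using (g.2.1 _ _).2 this
    · exact (finsum_comp_equiv g.1.symm).trans hsum⟩
  continuous_toFun := by
    refine Continuous.subtype_mk (continuous_pi fun v => ?_) _
    exact (continuous_apply _).comp continuous_subtype_val

/-- The compact-open topology on `G`. -/
instance {S Φ W : Type*} [Group W] {M : CoxeterMatrix S} (C : ChamberSystem S Φ)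
    (cs : CoxeterSystem M W) : TopologicalSpace (C.Aut cs) :=
  TopologicalSpace.induced Aut.toContinuousMap inferInstance

/-- The subgroup `G₀ = Aut₀(X)` of type-preserving automorphisms (with the subspace topology). -/
def typePreserving {S Φ W : Type*} [Group W] {M : CoxeterMatrix S} (C : ChamberSystem S Φ)
    (cs : CoxeterSystem M W) : Subgroup (C.Aut cs) where
  carrier := {g | ∀ v, (g.1 v).type = v.type}
  one_mem' := fun _ => rfl
  mul_mem' := fun {g h} hg hh v => (hg (h.1 v)).trans (hh v)
  inv_mem' := fun {g} hg v => by
    have := hg (g.1⁻¹ v)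
    simpa using this.symm

end ChamberSystem

/-! Since $X$ is locally finite, the pointwise stabilizers of finite sets of vertices form a
neighborhood basis of the identity, so a group of automorphisms is discrete exactly when one of
these stabilizers is trivial.

Nontrivial automorphisms fixing a large ball are built from colorings. Fix a chamber $c$ and color
every $s$-panel bijectively by $0,\dots,q_s-1$, giving $0$ to the chamber nearest $c$ and keeping
colors constant across panels of other types commuting with $s$ (`exists_isColoring`). A chamber is
then encoded by the types and colors of the steps of a minimal gallery from $c$. Two descents
commute in a right-angled group (`eq_two_of_isRightDescent`), so the choice of the last step can be
corrected by squares, and squares preserve colors. Hence one may re-read the code in another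
coloring, and also change types by permutations $\tau_x$ of $S$ that agree on the star of $s$ across
each $s$-panel. The result is an automorphism (`transport_spec`,
`IsTwist.exists_aut_of_isColoring`).

The retraction to an infinite dihedral group generated by $a,b$ gives each chamber an integer
position, and a half-line of positions is a half space crossed only by panels of one chosen type,
$a$ or $b$. If $q_s>2$ and $m_{st}=\infty$, swap two nonzero colors of type $s$ beyond a distant
wall of type $t$. If $\sigma\neq 1$ fixes the star of $a$, twist by $\sigma$ beyond a distant wall
of type $a$.

Conversely, if all $t$ with $q_t>2$ are central, they span a finite residue. A type-preserving
automorphism fixing it is the identity: all remaining panels have two chambers, so fixedness spreads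
to neighboring residues (`eq_one_of_fixes`). A general automorphism acts on types at each chamber by
an automorphism of $L$, and these agree on the star of $s$ across $s$-panels (`Aut.exists_twist`).
Rigidity spreads triviality of this action from one chamber to all. -/

namespace CoxeterSystem

/-! ### Right-angled Coxeter groups: inversions and the exchange condition -/

variable {S W : Type*} [Group W] {M : CoxeterMatrix S}

theorem _root_.CoxeterMatrix.IsRightAngled.isLiftable (hM : M.IsRightAngled) {G : Type*} [Monoid G]
    {f : S → G} (h1 : ∀ s, f s * f s = 1)
    (h2 : ∀ s t, s ≠ t → M s t = 2 → (f s * f t) * (f s * f t) = 1) : M.IsLiftable f := by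
  intro s t
  by_cases hst : s = t
  · subst hst; simp [h1]
  · rcases hM s t hst with h | h
    · rw [h, pow_two]; exact h2 s t hst h
    · rw [h, pow_zero]

theorem simple_comm (cs : CoxeterSystem M W) {s t : S} (h : M s t = 2) :
    cs.simple s * cs.simple t = cs.simple t * cs.simple s := by
  have h1 := cs.simple_mul_simple_pow s t
  rw [h, pow_two] at h1
  have h2 := eq_inv_of_mul_eq_one_left h1
  simpa using h2

open Classical in
/-- The Kronecker delta with values in `ZMod 2`. -/
noncomputable def kronecker {α : Type*} (a b : α) : ZMod 2 := if a = b then 1 else 0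

theorem kronecker_congr {α : Type*} {a b c d : α} (h : a = b ↔ c = d) :
    kronecker a b = kronecker c d := by
  unfold kronecker
  by_cases h' : c = d
  · rw [if_pos h', if_pos (h.2 h')]
  · rw [if_neg h', if_neg (mt h.1 h')]

/-- The map `(r, ε) ↦ (s r s, ε + [r = s])`, whose second component counts inversions
modulo two. -/
noncomputable def inversionFun (cs : CoxeterSystem M W) (s : S) (p : W × ZMod 2) : W × ZMod 2 :=
  (cs.simple s * p.1 * cs.simple s, p.2 + kronecker p.1 (cs.simple s))

theorem simple_conj_eq_iff (cs : CoxeterSystem M W) {a b : S}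
    (hab : cs.simple a * cs.simple b = cs.simple b * cs.simple a) (x : W) :
    cs.simple a * x * cs.simple a = cs.simple b ↔ x = cs.simple b := by
  constructor
  · intro h
    have := congrArg (fun x => cs.simple a * x * cs.simple a) h
    simpa [mul_assoc, ← hab] using this
  · rintro rfl; simp [hab, mul_assoc]

theorem inversionFun_involutive (cs : CoxeterSystem M W) (s : S) :
    Function.Involutive (cs.inversionFun s) := by
  rintro ⟨r, ε⟩
  simp only [inversionFun, kronecker_congr (cs.simple_conj_eq_iff (rfl :
    cs.simple s * cs.simple s = cs.simple s * cs.simple s) r)]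
  rw [add_assoc, CharTwo.add_self_eq_zero]
  simp [mul_assoc]

theorem inversionFun_comm (cs : CoxeterSystem M W) {s t : S} (h : M s t = 2) (p : W × ZMod 2) :
    cs.inversionFun s (cs.inversionFun t p) = cs.inversionFun t (cs.inversionFun s p) := by
  obtain ⟨r, ε⟩ := p
  have hc := cs.simple_comm h
  simp only [inversionFun, kronecker_congr (cs.simple_conj_eq_iff hc r),
    kronecker_congr (cs.simple_conj_eq_iff hc.symm r)]
  refine Prod.ext ?_ (add_right_comm _ _ _)
  calc _ = (cs.simple s * cs.simple t) * r * (cs.simple t * cs.simple s) := by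
        simp only [mul_assoc]
    _ = _ := by rw [hc, ← hc]; simp only [mul_assoc, hc]

/-- The permutation `(r, ε) ↦ (s r s, ε + [r = s])`. -/
noncomputable def inversionStep (cs : CoxeterSystem M W) (s : S) : Equiv.Perm (W × ZMod 2) :=
  (cs.inversionFun_involutive s).toPerm

theorem isLiftable_inversionStep (hM : M.IsRightAngled) (cs : CoxeterSystem M W) :
    M.IsLiftable cs.inversionStep := by
  refine hM.isLiftable (fun s => Equiv.ext fun p => cs.inversionFun_involutive s p)
    (fun s t _ h => Equiv.ext fun p => ?_)
  change cs.inversionFun s (cs.inversionFun t (cs.inversionFun s (cs.inversionFun t p))) = p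
  rw [cs.inversionFun_comm h, cs.inversionFun_involutive s, cs.inversionFun_involutive t]

/-- The homomorphism to `ℤˣ` that maps `s` to `-1` and all other generators to `1`. -/
noncomputable def signHom (hM : M.IsRightAngled) (cs : CoxeterSystem M W) (s : S) : W →* ℤˣ := by
  classical
  exact cs.lift ⟨fun t => if t = s then -1 else 1, hM.isLiftable
    (fun t => by split_ifs <;> simp) (fun t u _ _ => by split_ifs <;> simp)⟩

theorem signHom_self (hM : M.IsRightAngled) (cs : CoxeterSystem M W) (s : S) :
    signHom hM cs s (cs.simple s) = -1 := by
  unfold signHom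
  rw [lift_apply_simple]; simp

theorem signHom_of_ne (hM : M.IsRightAngled) (cs : CoxeterSystem M W) {s t : S} (h : t ≠ s) :
    signHom hM cs s (cs.simple t) = 1 := by
  unfold signHom
  rw [lift_apply_simple]; simp [h]

theorem simple_mem_specialSubgroup_iff (hM : M.IsRightAngled) (cs : CoxeterSystem M W) {s : S}
    {T : Set S} : cs.simple s ∈ cs.specialSubgroup T ↔ s ∈ T := by
  constructor
  · intro h
    by_contra hs
    have hle : cs.specialSubgroup T ≤ (signHom hM cs s).ker := by
      refine (Subgroup.closure_le _).2 ?_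
      rintro _ ⟨t, ht, rfl⟩
      exact signHom_of_ne hM cs (by rintro rfl; exact hs ht)
    have := hle h
    rw [MonoidHom.mem_ker, signHom_self] at this
    exact absurd this (by decide)
  · intro h
    exact Subgroup.subset_closure ⟨s, h, rfl⟩

theorem simple_inj (hM : M.IsRightAngled) (cs : CoxeterSystem M W) {s t : S} :
    cs.simple s = cs.simple t ↔ s = t := by
  refine ⟨fun h => ?_, fun h => h ▸ rfl⟩
  have : cs.simple s ∈ cs.specialSubgroup ({t} : Set S) := h ▸ Subgroup.subset_closure ⟨t, rfl, rfl⟩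
  exact (simple_mem_specialSubgroup_iff hM cs (s := s) (T := {t})).1 this

-- The left side depends only on the product of the word, so the parity of the number of occurrences
-- of `r` in the right inversion sequence is an invariant of the group element. This invariance
-- drives the exchange condition.
open Classical in
theorem lift_inversionStep_wordProd (hM : M.IsRightAngled) (cs : CoxeterSystem M W) (ω : List S)
    (r : W) (ε : ZMod 2) :
    cs.lift ⟨_, isLiftable_inversionStep hM cs⟩ (cs.wordProd ω) (r, ε) =
      (cs.wordProd ω * r * (cs.wordProd ω)⁻¹, ε + ((cs.rightInvSeq ω).count r : ℕ)) := by
  induction ω with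
  | nil => simp
  | cons i ω ih =>
    rw [wordProd_cons, map_mul, Equiv.Perm.mul_apply, ih, lift_apply_simple]
    change cs.inversionFun i _ = _
    simp only [inversionFun, rightInvSeq, List.count_cons]
    refine Prod.ext ?_ ?_
    · simp [mul_assoc]
    · have : (cs.wordProd ω * r * (cs.wordProd ω)⁻¹ = cs.simple i) ↔
          ((cs.wordProd ω)⁻¹ * cs.simple i * cs.wordProd ω = r) := by
        constructor
        · intro h; rw [← h]; group
        · intro h; rw [← h]; group
      simp only [beq_iff_eq, kronecker, this]
      push_cast
      ring

/-- The exchange condition. -/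
theorem exchange (hM : M.IsRightAngled) (cs : CoxeterSystem M W) {ω : List S} {s : S}
    (h : cs.IsRightDescent (cs.wordProd ω) s) :
    ∃ j < ω.length, cs.wordProd ω * cs.simple s = cs.wordProd (ω.eraseIdx j) := by
  classical
  obtain ⟨ω', hω', hw⟩ := cs.exists_isReduced (cs.wordProd ω * cs.simple s)
  have h1 : cs.wordProd (ω'.concat s) = cs.wordProd ω := by
    rw [wordProd_concat, ← hw]; simp
  have h2 : cs.simple s ∉ cs.rightInvSeq ω' := by
    intro hmem
    have := (cs.isRightInversion_of_mem_rightInvSeq hω' hmem).2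
    rw [← hw] at this
    simp only [simple_mul_simple_cancel_right] at this
    unfold IsRightDescent at h
    omega
  have e1 := lift_inversionStep_wordProd hM cs ω (cs.simple s) 0
  rw [← h1, lift_inversionStep_wordProd hM cs _ (cs.simple s) 0] at e1
  have e2 := congrArg Prod.snd e1
  -- The last entry is `s`; any other occurrence would be a conjugate by `s` of an occurrence in
  -- `ω'`, excluded by `h2`. So the count is odd for every word representing the same element, in
  -- particular for `ω`.
  have h3 : (cs.rightInvSeq (ω'.concat s)).count (cs.simple s) = 1 := by
    rw [rightInvSeq_concat, List.concat_eq_append, List.count_append]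
    simp only [List.count_singleton_self, Nat.add_eq_right]
    rw [List.count_eq_zero]
    intro hmem
    obtain ⟨r, hr, hr'⟩ := List.mem_map.1 hmem
    apply h2
    have : r = cs.simple s := by
      have := congrArg (fun x => cs.simple s * x * cs.simple s) hr'
      simpa [mul_assoc] using this
    rwa [this] at hr
  simp only [h3, zero_add, Nat.cast_one] at e2
  have h4 : cs.simple s ∈ cs.rightInvSeq ω := by
    by_contra hn
    rw [List.count_eq_zero.2 hn] at e2
    simp at e2
  obtain ⟨j, hj, hj'⟩ := List.mem_iff_getElem.1 h4
  have hj2 := hj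
  rw [length_rightInvSeq] at hj2
  refine ⟨j, hj2, ?_⟩
  rw [← wordProd_mul_getD_rightInvSeq, List.getD_eq_getElem _ _ hj, hj']

/-! ### The infinite dihedral retraction, descents and spherical subsets -/

open Classical in
/-- The action on `ℤ` of the letter `s`: `a` exchanges `2k` and `2k + 1`, `b` exchanges `2k - 1`
and `2k`, and all other letters act trivially. -/
noncomputable def dihedralFun (a b s : S) (n : ℤ) : ℤ :=
  if s = a then (if Even n then n + 1 else n - 1)
  else if s = b then (if Even n then n - 1 else n + 1) else n

theorem dihedralFun_involutive (a b s : S) : Function.Involutive (dihedralFun a b s) := by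
  intro n
  unfold dihedralFun
  split_ifs <;> grind

/-- The permutation of `ℤ` given by the letter `s`. -/
noncomputable def dihedralStep (a b s : S) : Equiv.Perm ℤ :=
  (dihedralFun_involutive a b s).toPerm

theorem dihedralStep_apply (a b s : S) (n : ℤ) : dihedralStep a b s n = dihedralFun a b s n := rfl

theorem abs_dihedralFun_le (a b s : S) (n : ℤ) : |dihedralFun a b s n| ≤ |n| + 1 := by
  unfold dihedralFun
  split_ifs <;> grind

theorem isLiftable_dihedralStep (hM : M.IsRightAngled) {a b : S} (hab : M a b = 0) :
    M.IsLiftable (dihedralStep a b) := by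
  have id_of : ∀ s, s ≠ a → s ≠ b → dihedralStep a b s = 1 := by
    intro s h1 h2
    ext n
    simp [dihedralStep_apply, dihedralFun, h1, h2]
  have inv : ∀ s, dihedralStep a b s * dihedralStep a b s = 1 := fun s =>
    Equiv.ext fun n => dihedralFun_involutive a b s n
  refine hM.isLiftable inv (fun s t hst h => ?_)
  have hba : M b a = 0 := by rw [M.symmetric, hab]
  by_cases h1 : s ≠ a ∧ s ≠ b
  · rw [id_of s h1.1 h1.2, one_mul, inv]
  · by_cases h2 : t ≠ a ∧ t ≠ b
    · rw [id_of t h2.1 h2.2, mul_one, inv]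
    · exfalso
      have h1' : s = a ∨ s = b := by tauto
      have h2' : t = a ∨ t = b := by tauto
      rcases h1' with rfl | rfl <;> rcases h2' with rfl | rfl <;> simp_all

/-- The homomorphism `W → Perm ℤ` through the retraction onto the infinite dihedral group generated
by `a` and `b`. -/
noncomputable def dihedralHom (hM : M.IsRightAngled) (cs : CoxeterSystem M W) {a b : S}
    (hab : M a b = 0) : W →* Equiv.Perm ℤ :=
  cs.lift ⟨_, isLiftable_dihedralStep hM hab⟩

theorem dihedralHom_simple (hM : M.IsRightAngled) (cs : CoxeterSystem M W) {a b : S}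
    (hab : M a b = 0) (s : S) : dihedralHom hM cs hab (cs.simple s) = dihedralStep a b s :=
  cs.lift_apply_simple _ s

theorem abs_dihedralHom_wordProd_le (hM : M.IsRightAngled) (cs : CoxeterSystem M W) {a b : S}
    (hab : M a b = 0) (ω : List S) : |dihedralHom hM cs hab (cs.wordProd ω) 0| ≤ ω.length := by
  induction ω with
  | nil => simp
  | cons i ω ih =>
    rw [wordProd_cons, map_mul, Equiv.Perm.mul_apply, dihedralHom_simple]
    refine (abs_dihedralFun_le _ _ _ _).trans ?_
    simp only [List.length_cons]; push_cast; linarith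

theorem abs_dihedralHom_le (hM : M.IsRightAngled) (cs : CoxeterSystem M W) {a b : S}
    (hab : M a b = 0) (w : W) : |dihedralHom hM cs hab w 0| ≤ cs.length w := by
  obtain ⟨ω, hω, rfl⟩ := cs.exists_isReduced w
  rw [hω.eq]
  exact abs_dihedralHom_wordProd_le hM cs hab ω

/-- Alternating letters keep pushing `0` to the right, while a word of length `k` moves `0` by at
most `k`; hence alternating words are reduced and pairwise distinct. -/
theorem dihedralHom_alternatingWord (hM : M.IsRightAngled) (cs : CoxeterSystem M W) {a b : S}
    (hab : M a b = 0) (k : ℕ) :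
    dihedralHom hM cs hab (cs.wordProd (alternatingWord b a k)) 0 = k := by
  have hne : b ≠ a := by rintro rfl; simp at hab
  induction k with
  | zero => simp [alternatingWord]
  | succ k ih =>
    rw [alternatingWord_succ', wordProd_cons, map_mul, Equiv.Perm.mul_apply, ih,
      dihedralHom_simple, dihedralStep_apply]
    unfold dihedralFun
    by_cases hk : Even k
    · have : Even (k : ℤ) := by exact_mod_cast hk
      simp [hk]
    · have : ¬ Even (k : ℤ) := by exact_mod_cast hk
      simp [hk, hne]

/-- Two descents with $m_{st}=\infty$ would force arbitrarily long alternating suffixes, which is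
absurd for an element of finite length. In the induction, the suffix ends in `s`, and exchange
against the descent `t` deletes a letter before the suffix, so `t` can be appended to it. -/
theorem exists_alternatingWord_suffix (hM : M.IsRightAngled) (cs : CoxeterSystem M W) {w : W}
    (k : ℕ) : ∀ {s t : S}, M s t = 0 → cs.IsRightDescent w s → cs.IsRightDescent w t →
    ∃ u, w = u * cs.wordProd (alternatingWord s t k) ∧ cs.length u + k = cs.length w := by
  induction k with
  | zero => intro s t _ _ _; exact ⟨w, by simp [alternatingWord], rfl⟩
  | succ k ih =>
    intro s t hst hs ht
    have hts : M t s = 0 := by rw [M.symmetric, hst]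
    obtain ⟨u, hu, hlen⟩ := ih hts ht hs
    obtain ⟨ω, hω, rfl⟩ := cs.exists_isReduced u
    rw [← wordProd_append] at hu
    have ht' := ht
    rw [hu] at ht'
    obtain ⟨j, hj, he⟩ := exchange hM cs ht'
    rw [← hu] at he
    rw [IsReduced] at hω
    have hconcat : cs.wordProd (alternatingWord s t (k + 1)) =
        cs.wordProd (alternatingWord t s k) * cs.simple t := by
      rw [alternatingWord_succ, wordProd_concat]
    by_cases hjω : j < ω.length
    · rw [List.eraseIdx_append_of_lt_length hjω, wordProd_append] at he
      have hw : w = cs.wordProd (ω.eraseIdx j) * cs.wordProd (alternatingWord s t (k + 1)) := by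
        rw [hconcat, ← mul_assoc, ← he]; simp
      refine ⟨_, hw, ?_⟩
      have h1 := cs.length_wordProd_le (ω.eraseIdx j)
      have h2 := List.length_eraseIdx_add_one hjω
      have h3 := cs.length_mul_le (cs.wordProd (ω.eraseIdx j))
        (cs.wordProd (alternatingWord s t (k + 1)))
      have h4 := cs.length_wordProd_le (alternatingWord s t (k + 1))
      rw [length_alternatingWord] at h4
      rw [← hw] at h3
      omega
    -- A deletion inside the suffix would express an alternating element of length `k + 1` by at
    -- most `k` letters, too few to move `0` to `k + 1`.
    · exfalso
      rw [List.eraseIdx_append_of_length_le (by omega), wordProd_append, hu, wordProd_append,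
        mul_assoc, ← hconcat] at he
      have he' := mul_left_cancel he
      have h1 := dihedralHom_alternatingWord hM cs hts (k + 1)
      rw [he'] at h1
      have h2 := abs_dihedralHom_wordProd_le hM cs hts
        ((alternatingWord t s k).eraseIdx (j - ω.length))
      rw [h1] at h2
      have h3 : ((alternatingWord t s k).eraseIdx (j - ω.length)).length ≤ k := by
        refine (List.length_eraseIdx_le _ _).trans ?_
        rw [length_alternatingWord]
      rw [abs_of_nonneg (by positivity)] at h2
      norm_cast at h2
      omega

/-- In a right-angled Coxeter group, two descents commute. -/
theorem eq_two_of_isRightDescent (hM : M.IsRightAngled) (cs : CoxeterSystem M W) {w : W} {s t : S}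
    (hst : s ≠ t) (hs : cs.IsRightDescent w s) (ht : cs.IsRightDescent w t) : M s t = 2 := by
  rcases hM s t hst with h | h
  · exact h
  · obtain ⟨u, _, hu⟩ := exists_alternatingWord_suffix hM cs (cs.length w + 1) h hs ht
    omega

/-- Apply exchange for `s` to a reduced word of `w` ending in `t`: the deleted letter cannot be the
final `t`, as `s ≠ t`, so `w * s` still has a short expression ending in `t`. -/
theorem isRightDescent_mul_simple (hM : M.IsRightAngled) (cs : CoxeterSystem M W) {w : W} {s t : S}
    (hst : s ≠ t) (hs : cs.IsRightDescent w s) (ht : cs.IsRightDescent w t) :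
    cs.IsRightDescent (w * cs.simple s) t := by
  obtain ⟨ω, hω, hw⟩ := cs.exists_isReduced (w * cs.simple t)
  have hw' : w = cs.wordProd (ω ++ [t]) := by
    rw [wordProd_append, ← hw]; simp
  have hs' := hs
  rw [hw'] at hs'
  obtain ⟨j, hj, he⟩ := exchange hM cs hs'
  rw [← hw'] at he
  rw [isRightDescent_iff] at hs ht
  by_cases hjω : j < ω.length
  · rw [List.eraseIdx_append_of_lt_length hjω, wordProd_append, wordProd_singleton] at he
    have h1 := cs.length_wordProd_le (ω.eraseIdx j)
    have h2 := List.length_eraseIdx_add_one hjω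
    rw [IsReduced, ← hw] at hω
    unfold IsRightDescent
    rw [he, simple_mul_simple_cancel_right, ← he]
    omega
  · exfalso
    have : j = ω.length := by simp at hj; omega
    subst this
    have : (ω ++ [t]).eraseIdx ω.length = ω := by
      rw [List.eraseIdx_append_of_length_le le_rfl]; simp
    rw [this, ← hw] at he
    have h3 := mul_left_cancel he
    exact hst ((simple_inj hM cs).1 h3)

/-- Multiplication by a generator commuting with `s` does not change whether `s` is a descent. -/
theorem isRightDescent_mul_simple_iff (hM : M.IsRightAngled) (cs : CoxeterSystem M W) {w : W}
    {s t : S} (hst : s ≠ t) (h2 : M s t = 2) :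
    cs.IsRightDescent (w * cs.simple t) s ↔ cs.IsRightDescent w s := by
  have key : ∀ u : W, cs.IsRightDescent u s → cs.IsRightDescent (u * cs.simple t) s := by
    intro u hs
    by_cases ht : cs.IsRightDescent u t
    · exact isRightDescent_mul_simple hM cs hst.symm ht hs
    · rw [isRightDescent_iff] at hs
      rw [not_isRightDescent_iff] at ht
      have h3 := cs.length_mul_le (u * cs.simple s) (cs.simple t)
      rw [length_simple, mul_assoc, cs.simple_comm h2, ← mul_assoc] at h3
      unfold IsRightDescent
      omega
  refine ⟨fun h => ?_, key w⟩
  simpa using key _ h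

open scoped IsMulCommutative in
/-- The pairwise commuting sets of generators are the spherical ones. -/
theorem isSpherical_iff (hM : M.IsRightAngled) (cs : CoxeterSystem M W) [Finite S] {T : Set S} :
    cs.IsSpherical T ↔ ∀ s ∈ T, ∀ t ∈ T, s ≠ t → M s t = 2 := by
  constructor
  · intro hT s hs t ht hst
    rcases hM s t hst with h | h
    · exact h
    · exfalso
      have hts : M t s = 0 := by rw [M.symmetric, h]
      have : Finite (cs.specialSubgroup T) := hT
      have hmem : ∀ k, cs.wordProd (alternatingWord s t k) ∈ cs.specialSubgroup T := by
        intro k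
        induction k generalizing s t with
        | zero => simp [alternatingWord, one_mem]
        | succ k ih =>
          rw [alternatingWord_succ, wordProd_concat]
          exact mul_mem (ih t ht s hs hst.symm hts h)
            (Subgroup.subset_closure ⟨t, ht, rfl⟩)
      refine not_injective_infinite_finite
        (fun k : ℕ => (⟨_, hmem k⟩ : cs.specialSubgroup T)) ?_
      intro k l hkl
      have h1 := dihedralHom_alternatingWord hM cs hts k
      have hkl' : cs.wordProd (alternatingWord s t k) = cs.wordProd (alternatingWord s t l) :=
        congrArg Subtype.val hkl
      rw [hkl', dihedralHom_alternatingWord hM cs hts l] at h1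
      exact_mod_cast h1.symm
  · intro h
    have hcomm : ∀ x ∈ cs.simple '' T, ∀ y ∈ cs.simple '' T, x * y = y * x := by
      rintro _ ⟨s, hs, rfl⟩ _ ⟨t, ht, rfl⟩
      by_cases hst : s = t
      · rw [hst]
      · exact cs.simple_comm (h s hs t ht hst)
    have hfin : (cs.simple '' T).Finite := (Set.toFinite T).image _
    have : IsMulCommutative (Subgroup.closure (cs.simple '' T)) :=
      Subgroup.isMulCommutative_closure hcomm
    have : Finite (cs.simple '' T) := hfin.to_subtype
    have htors : IsMulTorsion (Subgroup.closure (cs.simple '' T)) := by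
      have hsq : ∀ x ∈ Subgroup.closure (cs.simple '' T), x * x = 1 := by
        intro x hx
        induction hx using Subgroup.closure_induction with
        | mem x hx => obtain ⟨s, _, rfl⟩ := hx; simp
        | one => simp
        | mul x y hx hy ihx ihy =>
          have : x * y = y * x := by
            have := mul_comm (⟨x, hx⟩ : Subgroup.closure (cs.simple '' T)) ⟨y, hy⟩
            exact congrArg Subtype.val this
          calc x * y * (x * y) = x * (y * x) * y := by group
            _ = (x * x) * (y * y) := by rw [← this]; group
            _ = 1 := by rw [ihx, ihy, one_mul]
        | inv x _ ih => rw [← mul_inv_rev, ih, inv_one]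
      refine fun x => isOfFinOrder_iff_pow_eq_one.2 ⟨2, by norm_num, ?_⟩
      rw [pow_two]
      exact Subtype.ext (hsq x.1 x.2)
    exact CommGroup.finite_of_fg_isMulTorsion (Subgroup.closure (cs.simple '' T)) htors

end CoxeterSystem

/-! ### Galleries, residues, gates and squares in a building -/

namespace ChamberSystem

variable {S W Φ : Type*} [Group W] {M : CoxeterMatrix S} {cs : CoxeterSystem M W}
  {X : ChamberSystem S Φ} {δ : Φ → Φ → W}

/-- `X.Rel s x y`: the chambers `x` and `y` are `s`-equivalent. -/
abbrev Rel (X : ChamberSystem S Φ) (s : S) (x y : Φ) : Prop := (X.equivalence s).r x y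

theorem Rel.refl (X : ChamberSystem S Φ) (s : S) (x : Φ) : X.Rel s x x :=
  (X.equivalence s).iseqv.refl x

theorem Rel.symm {s : S} {x y : Φ} (h : X.Rel s x y) : X.Rel s y x :=
  (X.equivalence s).iseqv.symm h

theorem Rel.trans {s : S} {x y z : Φ} (h : X.Rel s x y) (h' : X.Rel s y z) : X.Rel s x z :=
  (X.equivalence s).iseqv.trans h h'

theorem hasGallery_nil_iff {x y : Φ} : X.HasGallery x y [] ↔ x = y :=
  ⟨fun h => by cases h; rfl, fun h => h ▸ .nil x⟩

theorem hasGallery_cons_iff {x y : Φ} {s : S} {w : List S} :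
    X.HasGallery x y (s :: w) ↔ ∃ z, X.Adjacent s x z ∧ X.HasGallery z y w :=
  ⟨fun h => by cases h with | cons h1 h2 => exact ⟨_, h1, h2⟩, fun ⟨_, h1, h2⟩ => .cons h1 h2⟩

theorem hasGallery_append_iff {x y : Φ} {v w : List S} :
    X.HasGallery x y (v ++ w) ↔ ∃ z, X.HasGallery x z v ∧ X.HasGallery z y w := by
  induction v generalizing x with
  | nil => simp [hasGallery_nil_iff]
  | cons s v ih =>
    simp only [List.cons_append, hasGallery_cons_iff, ih]
    constructor
    · rintro ⟨a, ha, b, hb, hb'⟩; exact ⟨b, ⟨a, ha, hb⟩, hb'⟩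
    · rintro ⟨b, ⟨a, ha, hb⟩, hb'⟩; exact ⟨a, ha, b, hb, hb'⟩

theorem hasGallery_singleton_iff {x y : Φ} {s : S} :
    X.HasGallery x y [s] ↔ X.Adjacent s x y := by
  simp [hasGallery_cons_iff, hasGallery_nil_iff]

theorem Adjacent.symm {s : S} {x y : Φ} (h : X.Adjacent s x y) : X.Adjacent s y x :=
  ⟨Rel.symm h.1, h.2.symm⟩

theorem HasGallery.reverse {x y : Φ} {w : List S} (h : X.HasGallery x y w) :
    X.HasGallery y x w.reverse := by
  induction h with
  | nil => exact .nil _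
  | cons h1 _ ih =>
    rw [List.reverse_cons, hasGallery_append_iff]
    exact ⟨_, ih, hasGallery_singleton_iff.2 h1.symm⟩

theorem mem_residue_self (X : ChamberSystem S Φ) (T : Set S) (x : Φ) : x ∈ X.residue T x :=
  ⟨[], by simp, .nil x⟩

theorem mem_residue_symm {T : Set S} {x y : Φ} (h : y ∈ X.residue T x) : x ∈ X.residue T y := by
  obtain ⟨w, hw, hg⟩ := h
  exact ⟨w.reverse, by simpa using hw, hg.reverse⟩

theorem mem_residue_trans {T : Set S} {x y z : Φ} (h : y ∈ X.residue T x)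
    (h' : z ∈ X.residue T y) : z ∈ X.residue T x := by
  obtain ⟨w, hw, hg⟩ := h
  obtain ⟨w', hw', hg'⟩ := h'
  refine ⟨w ++ w', ?_, hasGallery_append_iff.2 ⟨_, hg, hg'⟩⟩
  intro s hs
  rcases List.mem_append.1 hs with hs | hs
  · exact hw s hs
  · exact hw' s hs

theorem residue_eq_of_mem {T : Set S} {x y : Φ} (h : y ∈ X.residue T x) :
    X.residue T x = X.residue T y :=
  Set.ext fun _ => ⟨mem_residue_trans (mem_residue_symm h), mem_residue_trans h⟩

theorem Rel.mem_residue {s : S} {x y : Φ} (h : X.Rel s x y) {T : Set S} (hs : s ∈ T) :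
    y ∈ X.residue T x := by
  by_cases hxy : x = y
  · subst hxy; exact mem_residue_self X T x
  · exact ⟨[s], by simpa using hs, hasGallery_singleton_iff.2 ⟨h, hxy⟩⟩

theorem residue_mono {T T' : Set S} (h : T ⊆ T') (x : Φ) : X.residue T x ⊆ X.residue T' x :=
  fun _ ⟨w, hw, hg⟩ => ⟨w, fun s hs => h (hw s hs), hg⟩

/-- Induction along galleries in a residue. -/
theorem residue_induction {T : Set S} {x : Φ} {P : Φ → Prop} (base : P x)
    (step : ∀ s ∈ T, ∀ y z, X.Rel s y z → P y → P z) {y : Φ} (hy : y ∈ X.residue T x) : P y := by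
  obtain ⟨w, hw, hg⟩ := hy
  induction hg with
  | nil => exact base
  | @cons a b c s w h1 _ ih =>
    exact ih (step s (hw s (by simp)) _ _ h1.1 base) fun t ht => hw t (by simp [ht])

theorem residue_empty (x : Φ) : X.residue ∅ x = {x} := by
  ext y
  refine ⟨fun h => ?_, fun h => h ▸ mem_residue_self X ∅ x⟩
  refine residue_induction (P := fun z => z ∈ ({x} : Set Φ)) rfl ?_ h
  simp

theorem residue_singleton (s : S) (x : Φ) : X.residue {s} x = {y | X.Rel s x y} := by
  ext y
  refine ⟨fun h => ?_, fun h => Rel.mem_residue h rfl⟩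
  refine residue_induction (P := fun z => X.Rel s x z) (Rel.refl X s x) ?_ h
  rintro t rfl y z h1 h2
  exact h2.trans h1

/-- `δ` is a Weyl distance on `X`. -/
def IsWeylDistance (X : ChamberSystem S Φ) (cs : CoxeterSystem M W) (δ : Φ → Φ → W) : Prop :=
  ∀ w : List S, cs.IsReduced w → ∀ x y : Φ, X.HasGallery x y w ↔ δ x y = cs.wordProd w

namespace IsWeylDistance

variable (hδ : X.IsWeylDistance cs δ)
include hδ

theorem eq_one_iff {x y : Φ} : δ x y = 1 ↔ x = y := by
  have := hδ [] (by simp [CoxeterSystem.IsReduced]) x y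
  rw [hasGallery_nil_iff] at this
  simpa using this.symm

theorem self (x : Φ) : δ x x = 1 := hδ.eq_one_iff.2 rfl

theorem eq_simple_iff {x y : Φ} {s : S} : δ x y = cs.simple s ↔ X.Adjacent s x y := by
  have := hδ [s] (by simp [CoxeterSystem.IsReduced]) x y
  rw [hasGallery_singleton_iff] at this
  simpa using this.symm

theorem connected (x y : Φ) : y ∈ X.residue Set.univ x := by
  obtain ⟨w, hw, h⟩ := cs.exists_isReduced (δ x y)
  exact ⟨w, by simp, (hδ w hw x y).2 h⟩

theorem mul_simple {c x y : Φ} {s : S} (h : X.Rel s x y) (hxy : x ≠ y)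
    (hs : ¬ cs.IsRightDescent (δ c x) s) : δ c y = δ c x * cs.simple s := by
  obtain ⟨w, hw, h'⟩ := cs.exists_isReduced (δ c x)
  have hprod : cs.wordProd (w ++ [s]) = δ c x * cs.simple s := by
    rw [cs.wordProd_append, ← h']; simp
  have hred : cs.IsReduced (w ++ [s]) := by
    rw [CoxeterSystem.not_isRightDescent_iff] at hs
    rw [CoxeterSystem.IsReduced, hprod, hs, h', hw]; simp
  rw [← hprod]
  refine (hδ _ hred c y).1 (hasGallery_append_iff.2 ⟨x, (hδ w hw c x).2 h', ?_⟩)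
  exact hasGallery_singleton_iff.2 ⟨h, hxy⟩

/-- If `s` is a descent, a reduced gallery from `c` to `x` can be chosen with last step `s`; its
penultimate chamber is the gate. -/
theorem exists_gate (c x : Φ) (s : S) : ∃ z, X.Rel s z x ∧ ¬ cs.IsRightDescent (δ c z) s := by
  by_cases hs : cs.IsRightDescent (δ c x) s
  · obtain ⟨w, hw, h'⟩ := cs.exists_isReduced (δ c x * cs.simple s)
    have hprod : cs.wordProd (w ++ [s]) = δ c x := by
      rw [cs.wordProd_append, ← h']; simp
    have hs' := hs
    rw [CoxeterSystem.isRightDescent_iff] at hs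
    have hred : cs.IsReduced (w ++ [s]) := by
      rw [CoxeterSystem.IsReduced, hprod, ← hs, h', hw]; simp
    obtain ⟨z, hz, hzx⟩ := hasGallery_append_iff.1 ((hδ _ hred c x).2 hprod.symm)
    refine ⟨z, (hasGallery_singleton_iff.1 hzx).1, ?_⟩
    rw [(hδ w hw c z).1 hz, ← h']
    exact (cs.isRightDescent_iff_not_isRightDescent_mul).1 hs'
  · exact ⟨x, Rel.refl X s x, hs⟩

theorem gate_unique {c x y : Φ} {s : S} (h : X.Rel s x y) (hx : ¬ cs.IsRightDescent (δ c x) s)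
    (hy : ¬ cs.IsRightDescent (δ c y) s) : x = y := by
  by_contra hxy
  have := hδ.mul_simple h hxy hx
  rw [this] at hy
  exact hx ((cs.isRightDescent_iff_not_isRightDescent_mul).2 hy)

theorem eq_or_eq_mul_simple {x y : Φ} {s : S} (c : Φ) (h : X.Rel s x y) :
    δ c y = δ c x ∨ δ c y = δ c x * cs.simple s := by
  obtain ⟨z, hz, hzs⟩ := hδ.exists_gate c x s
  by_cases hzx : z = x
  · subst hzx
    by_cases hzy : z = y
    · subst hzy; exact .inl rfl
    · exact .inr (hδ.mul_simple h hzy hzs)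
  · have h1 := hδ.mul_simple hz hzx hzs
    by_cases hzy : z = y
    · subst hzy; right; rw [h1]; simp
    · left; rw [h1, hδ.mul_simple (hz.trans h) hzy hzs]

theorem mem_specialSubgroup {x y : Φ} {T : Set S} (h : y ∈ X.residue T x) :
    δ x y ∈ cs.specialSubgroup T := by
  refine residue_induction (P := fun y => δ x y ∈ cs.specialSubgroup T) ?_ ?_ h
  · rw [hδ.self]; exact one_mem _
  · intro s hs y z hyz hy
    rcases hδ.eq_or_eq_mul_simple x hyz with h | h <;> rw [h]
    · exact hy
    · exact mul_mem hy (Subgroup.subset_closure ⟨s, hs, rfl⟩)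

theorem mem_of_adjacent_of_mem_residue (hM : M.IsRightAngled) {x y : Φ} {s : S} {T : Set S}
    (hxy : X.Adjacent s x y) (h : y ∈ X.residue T x) : s ∈ T := by
  have := hδ.mem_specialSubgroup h
  rw [hδ.eq_simple_iff.2 hxy] at this
  exact (CoxeterSystem.simple_mem_specialSubgroup_iff hM cs).1 this

theorem exists_square (hM : M.IsRightAngled) {x y z : Φ} {s t : S} (hst : s ≠ t) (h2 : M s t = 2)
    (hxy : X.Rel s x y) (hyz : X.Rel t y z) : ∃ y', X.Rel t x y' ∧ X.Rel s y' z := by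
  by_cases hxy' : x = y
  · subst hxy'; exact ⟨z, hyz, Rel.refl X s z⟩
  by_cases hyz' : y = z
  · subst hyz'; exact ⟨x, Rel.refl X t x, hxy⟩
  have hred : ∀ {a b : S}, a ≠ b → cs.IsReduced [a, b] := by
    intro a b hab
    have h1 : cs.length (cs.simple a * cs.simple b) ≠ 0 := by
      rw [Ne, cs.length_eq_zero_iff]
      intro h
      apply hab
      have := eq_inv_of_mul_eq_one_left h
      rw [cs.inv_simple] at this
      exact (CoxeterSystem.simple_inj hM cs).1 this
    have h3 := cs.length_mul_simple (cs.simple a) b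
    rw [cs.length_simple] at h3
    rw [CoxeterSystem.IsReduced, cs.wordProd_cons, cs.wordProd_singleton, List.length_cons,
      List.length_singleton]
    omega
  have hg : X.HasGallery x z [s, t] :=
    hasGallery_cons_iff.2 ⟨y, ⟨hxy, hxy'⟩, hasGallery_singleton_iff.2 ⟨hyz, hyz'⟩⟩
  have hg' : X.HasGallery x z [t, s] := by
    rw [hδ _ (hred hst.symm)]
    rw [hδ _ (hred hst)] at hg
    rw [hg, cs.wordProd_cons, cs.wordProd_singleton, cs.wordProd_cons, cs.wordProd_singleton,
      cs.simple_comm h2]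
  obtain ⟨y', h1, h2⟩ := hasGallery_cons_iff.1 hg'
  exact ⟨y', h1.1, (hasGallery_singleton_iff.1 h2).1⟩

theorem isRightDescent_iff_of_rel (hM : M.IsRightAngled) {c x y : Φ} {s t : S} (hst : s ≠ t)
    (h2 : M s t = 2) (h : X.Rel t x y) :
    cs.IsRightDescent (δ c y) s ↔ cs.IsRightDescent (δ c x) s := by
  rcases hδ.eq_or_eq_mul_simple c h with h | h <;> rw [h]
  exact CoxeterSystem.isRightDescent_mul_simple_iff hM cs hst h2

theorem exists_eq (hadj : ∀ s x, ∃ y, X.Adjacent s x y) (c : Φ) (w : W) : ∃ x, δ c x = w := by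
  obtain ⟨v, hv, rfl⟩ := cs.exists_isReduced w
  have : ∀ (v : List S) (x : Φ), ∃ y, X.HasGallery x y v := by
    intro v
    induction v with
    | nil => exact fun x => ⟨x, .nil x⟩
    | cons s v ih =>
      intro x
      obtain ⟨z, hz⟩ := hadj s x
      obtain ⟨y, hy⟩ := ih z
      exact ⟨y, .cons hz hy⟩
  obtain ⟨x, hx⟩ := this v c
  exact ⟨x, (hδ v hv c x).1 hx⟩

theorem finite_residue {q : S → ℕ} (hq : X.HasParameters q) {T : Set S} (hT : cs.IsSpherical T)
    (x : Φ) : (X.residue T x).Finite := by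
  have hfin : ∀ (v : List S) (x : Φ), {y | X.HasGallery x y v}.Finite := by
    intro v
    induction v with
    | nil => intro x; exact (Set.finite_singleton x).subset fun y hy => (hasGallery_nil_iff.1 hy).symm
    | cons s v ih =>
      intro x
      have h1 : {z | X.Adjacent s x z}.Finite := by
        refine Set.Finite.subset (s := {z | X.Rel s x z}) ?_ fun z hz => hz.1
        exact Set.encard_lt_top_iff.1 (by rw [hq s x]; exact ENat.natCast_lt_top _)
      refine (h1.biUnion fun z _ => ih z).subset ?_
      intro y hy
      obtain ⟨z, hz, hzy⟩ := hasGallery_cons_iff.1 hy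
      exact Set.mem_biUnion hz hzy
  have : Finite (cs.specialSubgroup T) := hT
  have hT' : (cs.specialSubgroup T : Set W).Finite := Set.toFinite _
  refine (hT'.biUnion (t := fun w => {y | δ x y = w}) fun w _ => ?_).subset ?_
  · obtain ⟨v, hv, rfl⟩ := cs.exists_isReduced w
    simpa only [hδ v hv] using hfin v x
  · intro y hy
    exact Set.mem_biUnion (hδ.mem_specialSubgroup hy) rfl

end IsWeylDistance

end ChamberSystem

/-! ### Colorings -/

namespace ChamberSystem

variable {S W Φ : Type*} [Group W] {M : CoxeterMatrix S} {cs : CoxeterSystem M W}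
  {X : ChamberSystem S Φ} {δ : Φ → Φ → W} {c : Φ} {q : S → ℕ}

/-- A family of colorings `h s` of the chambers that is bijective on `s`-panels, constant along
the `t`-panels with `t ≠ s` commuting with `s`, and that gives the color `0` to the chamber of each
panel nearest to the base chamber `c`. -/
structure IsColoring (X : ChamberSystem S Φ) (cs : CoxeterSystem M W) (δ : Φ → Φ → W) (c : Φ)
    (q : S → ℕ) (h : S → Φ → ℕ) : Prop where
  lt : ∀ s x, h s x < q s
  inj : ∀ {s x y}, X.Rel s x y → h s x = h s y → x = y
  surj : ∀ {s} x {a}, a < q s → ∃ y, X.Rel s x y ∧ h s y = a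
  const : ∀ {s t x y}, s ≠ t → M s t = 2 → X.Rel t x y → h s x = h s y
  zero : ∀ {s x}, ¬ cs.IsRightDescent (δ c x) s → h s x = 0

theorem IsColoring.eq_zero_iff (hδ : X.IsWeylDistance cs δ) {h : S → Φ → ℕ}
    (hh : X.IsColoring cs δ c q h) {s : S} {x : Φ} :
    h s x = 0 ↔ ¬ cs.IsRightDescent (δ c x) s := by
  refine ⟨fun h0 => ?_, hh.zero⟩
  obtain ⟨z, hz, hzs⟩ := hδ.exists_gate c x s
  have := hh.inj hz ((hh.zero hzs).trans h0.symm)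
  exact this ▸ hzs

/-- The generators different from `s` that commute with `s`. -/
def perp (M : CoxeterMatrix S) (s : S) : Set S := {t | s ≠ t ∧ M s t = 2}

/-- Squares carry an `s`-step along a gallery whose types commute with `s`: parallel `s`-panels are
matched in this way. -/
theorem IsWeylDistance.exists_rel_of_mem_residue (hM : M.IsRightAngled)
    (hδ : X.IsWeylDistance cs δ) {s : S} {T : Set S} (hT : T ⊆ perp M s) {x y z : Φ}
    (h : y ∈ X.residue T x) (hz : X.Rel s y z) : ∃ x', X.Rel s x x' ∧ z ∈ X.residue T x' := by
  revert z
  refine residue_induction (P := fun y => ∀ {z}, X.Rel s y z →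
    ∃ x', X.Rel s x x' ∧ z ∈ X.residue T x') ?_ ?_ h
  · intro z hz; exact ⟨z, hz, mem_residue_self X _ z⟩
  · intro t ht y y' hyy' ih z hz
    obtain ⟨w, hw1, hw2⟩ := hδ.exists_square hM (hT ht).1.symm
      (by rw [M.symmetric]; exact (hT ht).2) hyy' hz
    obtain ⟨x', hx', hx''⟩ := ih hw1
    exact ⟨x', hx', mem_residue_trans hx'' (hw2.mem_residue ht)⟩

theorem IsWeylDistance.eq_of_mem_residue_perp (hM : M.IsRightAngled)
    (hδ : X.IsWeylDistance cs δ) {s : S} {x y : Φ} (h : y ∈ X.residue (perp M s) x)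
    (hxy : X.Rel s x y) : x = y := by
  by_contra hne
  exact (hδ.mem_of_adjacent_of_mem_residue hM ⟨hxy, hne⟩ h).1 rfl

theorem HasParameters.exists_bijOn (hq : X.HasParameters q) (s : S) (p : Φ) :
    ∃ e : Φ → ℕ, Set.BijOn e {y | X.Rel s p y} (Set.Iio (q s)) ∧ e p = 0 := by
  have h1 : {y | X.Rel s p y}.encard = (q s : ℕ∞) := hq s p
  have hfin : {y | X.Rel s p y}.Finite :=
    Set.encard_lt_top_iff.1 (by rw [h1]; exact ENat.natCast_lt_top _)
  have : Nonempty Φ := ⟨p⟩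
  obtain ⟨f, hf⟩ := hfin.exists_bijOn_of_encard_eq (t := Set.Iio (q s)) (by
    rw [h1, Set.encard_eq_coe_toFinset_card]; simp)
  have hp : p ∈ {y | X.Rel s p y} := Rel.refl X s p
  have hlt : f p < q s := hf.mapsTo hp
  refine ⟨fun y => Equiv.swap (f p) 0 (f y), ?_, by simp⟩
  have hs : Set.BijOn (Equiv.swap (f p) 0) (Set.Iio (q s)) (Set.Iio (q s)) := by
    refine ⟨fun a ha => ?_, (Equiv.injective _).injOn, fun a ha => ?_⟩
    · simp only [Set.mem_Iio] at ha ⊢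
      rw [Equiv.swap_apply_def]; split_ifs <;> omega
    · refine ⟨Equiv.swap (f p) 0 a, ?_, by simp⟩
      simp only [Set.mem_Iio] at ha ⊢
      rw [Equiv.swap_apply_def]; split_ifs <;> omega
  exact hs.comp hf

theorem exists_isColoring (hM : M.IsRightAngled) (hδ : X.IsWeylDistance cs δ)
    (hq : X.HasParameters q) (c : Φ) : ∃ h, X.IsColoring cs δ c q h := by
  have key : ∀ s, ∃ k : Φ → ℕ, (∀ x, k x < q s) ∧ (∀ x y, X.Rel s x y → k x = k y → x = y) ∧
      (∀ x a, a < q s → ∃ y, X.Rel s x y ∧ k y = a) ∧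
      (∀ t x y, s ≠ t → M s t = 2 → X.Rel t x y → k x = k y) ∧
      (∀ x, ¬ cs.IsRightDescent (δ c x) s → k x = 0) := by
    intro s
    -- The representative is chosen for the residue as a set, so that all its chambers use the same
    -- reference panel. It is the gate of that panel, and is numbered `0`.
    have hrep : ∀ R : Set Φ, ∃ p, (∃ x, R = X.residue (insert s (perp M s)) x) →
        p ∈ R ∧ ¬ cs.IsRightDescent (δ c p) s := by
      intro R
      by_cases hR : ∃ x, R = X.residue (insert s (perp M s)) x
      · obtain ⟨x, rfl⟩ := hR
        obtain ⟨z, hz, hzs⟩ := hδ.exists_gate c x s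
        exact ⟨z, fun _ => ⟨hz.symm.mem_residue (Set.mem_insert _ _), hzs⟩⟩
      · exact ⟨c, fun h => absurd h hR⟩
    choose rep hrep using hrep
    choose e he he0 using fun p => hq.exists_bijOn s p
    set R : Φ → Set Φ := fun x => X.residue (insert s (perp M s)) x with hR
    -- Each chamber is projected to the reference panel along types commuting with `s`; its color is
    -- the number of the projection.
    have hproj : ∀ x, ∃ p, X.Rel s (rep (R x)) p ∧ p ∈ X.residue (perp M s) x := by
      intro x
      have hx : x ∈ R (rep (R x)) := mem_residue_symm (hrep (R x) ⟨x, rfl⟩).1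
      refine residue_induction
        (P := fun x' => ∃ p, X.Rel s (rep (R x)) p ∧ p ∈ X.residue (perp M s) x') ?_ ?_ hx
      · exact ⟨_, Rel.refl X s _, mem_residue_self X _ _⟩
      · rintro t ht y z hyz ⟨p, hp, hpy⟩
        rcases ht with rfl | ht
        · obtain ⟨p', hp', hp''⟩ := hδ.exists_rel_of_mem_residue hM subset_rfl (mem_residue_symm hpy) hyz
          exact ⟨p', hp.trans hp', mem_residue_symm hp''⟩
        · exact ⟨p, hp, mem_residue_trans (hyz.symm.mem_residue ht) hpy⟩
    choose p hp hp' using hproj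
    have huniq : ∀ x p', X.Rel s (rep (R x)) p' → p' ∈ X.residue (perp M s) x → p' = p x := by
      intro x p' h1 h2
      exact hδ.eq_of_mem_residue_perp hM (mem_residue_trans (mem_residue_symm h2) (hp' x))
        (h1.symm.trans (hp x))
    have hReq : ∀ t ∈ insert s (perp M s), ∀ x y, X.Rel t x y → R x = R y :=
      fun t ht x y h => residue_eq_of_mem (h.mem_residue ht)
    refine ⟨fun x => e (rep (R x)) (p x), fun x => (he _).mapsTo (hp x), ?_, ?_, ?_, ?_⟩
    · intro x y hxy hk
      have hRR := hReq s (Set.mem_insert _ _) x y hxy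
      have hpy := hp y
      simp only [← hRR] at hk hpy
      have := (he _).injOn (hp x) hpy hk
      refine hδ.eq_of_mem_residue_perp hM (mem_residue_trans (hp' x) ?_) hxy
      rw [this]; exact mem_residue_symm (hp' y)
    · intro x a ha
      obtain ⟨p'', hp'', rfl⟩ := (he (rep (R x))).surjOn ha
      obtain ⟨y, hy, hy'⟩ := hδ.exists_rel_of_mem_residue hM subset_rfl (hp' x) ((hp x).symm.trans hp'')
      refine ⟨y, hy, ?_⟩
      have hRR := hReq s (Set.mem_insert _ _) x y hy
      have : p'' = p y := huniq y p'' (by rw [← hRR]; exact hp'') hy'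
      simp only [← hRR, this]
    · intro t x y hst h2 hxy
      have ht : t ∈ perp M s := ⟨hst, h2⟩
      have hRR := hReq t (Set.mem_insert_of_mem _ ht) x y hxy
      have : p x = p y := huniq y (p x) (by rw [← hRR]; exact hp x)
        (mem_residue_trans (hxy.symm.mem_residue ht) (hp' x))
      simp only [hRR, this]
    · intro x hx
      -- Steps of types commuting with `s` do not affect whether `s` is a descent, so gates project
      -- to the reference gate.
      have hpx : ¬ cs.IsRightDescent (δ c (p x)) s := by
        refine residue_induction (P := fun y => ¬ cs.IsRightDescent (δ c y) s) hx ?_ (hp' x)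
        intro t ht y z hyz hy
        rwa [hδ.isRightDescent_iff_of_rel hM ht.1 ht.2 hyz]
      have := hδ.gate_unique (hp x) (hrep (R x) ⟨x, rfl⟩).2 hpx
      change e (rep (R x)) (p x) = 0
      rw [← this, he0]
  choose h h1 h2 h3 h4 h5 using key
  exact ⟨h, h1, h2 _ _ _, fun x _ ha => h3 _ x _ ha, h4 _ _ _ _, h5 _ _⟩

namespace IsWeylDistance

/-- The chamber of the `s`-panel of `x` that is nearest to `c`. -/
noncomputable def gate (hδ : X.IsWeylDistance cs δ) (c : Φ) (s : S) (x : Φ) : Φ :=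
  (hδ.exists_gate c x s).choose

variable (hδ : X.IsWeylDistance cs δ)
include hδ

theorem gate_rel (s : S) (x : Φ) : X.Rel s (hδ.gate c s x) x :=
  (hδ.exists_gate c x s).choose_spec.1

theorem gate_not_isRightDescent (s : S) (x : Φ) :
    ¬ cs.IsRightDescent (δ c (hδ.gate c s x)) s :=
  (hδ.exists_gate c x s).choose_spec.2

theorem gate_eq_of_rel {s : S} {x z : Φ} (h : X.Rel s z x)
    (hz : ¬ cs.IsRightDescent (δ c z) s) : hδ.gate c s x = z :=
  hδ.gate_unique ((hδ.gate_rel s x).trans h.symm) (hδ.gate_not_isRightDescent s x) hz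

theorem gate_eq_self {s : S} {x : Φ} (hx : ¬ cs.IsRightDescent (δ c x) s) : hδ.gate c s x = x :=
  hδ.gate_eq_of_rel (Rel.refl X s x) hx

theorem gate_eq_gate {s : S} {x y : Φ} (h : X.Rel s x y) : hδ.gate c s x = hδ.gate c s y :=
  hδ.gate_eq_of_rel ((hδ.gate_rel s y).trans h.symm) (hδ.gate_not_isRightDescent s y)

theorem length_gate_lt {s : S} {x : Φ} (hx : cs.IsRightDescent (δ c x) s) :
    cs.length (δ c (hδ.gate c s x)) < cs.length (δ c x) := by
  have hne : hδ.gate c s x ≠ x := fun h => hδ.gate_not_isRightDescent s x (by rwa [h])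
  have h1 := hδ.mul_simple (hδ.gate_rel s x) hne (hδ.gate_not_isRightDescent s x)
  have h2 := (cs.not_isRightDescent_iff).1 (hδ.gate_not_isRightDescent (c := c) s x)
  rw [h1, h2]; exact Nat.lt_succ_self _

end IsWeylDistance

/-! ### Twists and the transport map -/

/-- A compatible assignment of permutations of the types to the chambers: the permutations at
`s`-equivalent chambers agree on the star of `s`. -/
structure IsTwist (X : ChamberSystem S Φ) (M : CoxeterMatrix S) (q : S → ℕ)
    (τ : Φ → Equiv.Perm S) : Prop where
  matrix : ∀ x s t, M (τ x s) (τ x t) = M s t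
  param : ∀ x s, q (τ x s) = q s
  self : ∀ {s x y}, X.Rel s x y → τ x s = τ y s
  perp : ∀ {s x y}, X.Rel s x y → ∀ {t}, M s t = 2 → τ x t = τ y t

open Classical in
/-- The chamber of color `a` in the `s`-panel of `x`. -/
noncomputable def pick (X : ChamberSystem S Φ) (h : S → Φ → ℕ) (s : S) (x : Φ) (a : ℕ) : Φ :=
  if hy : ∃ y, X.Rel s x y ∧ h s y = a then hy.choose else x

theorem IsColoring.pick_spec {h : S → Φ → ℕ} (hh : X.IsColoring cs δ c q h) {s : S} {x : Φ}
    {a : ℕ} (ha : a < q s) : X.Rel s x (X.pick h s x a) ∧ h s (X.pick h s x a) = a := by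
  have hy := hh.surj x ha
  rw [pick, dif_pos hy]
  exact hy.choose_spec

open Classical in
/-- The map of chambers that fixes `c`, and maps a step of type `s` and color `a` away from `c` and
starting or ending in `x` to a step of type `τ x s` and color `a`. -/
noncomputable def transport (hδ : X.IsWeylDistance cs δ) (c : Φ) (τ : Φ → Equiv.Perm S)
    (h h' : S → Φ → ℕ) (x : Φ) : Φ :=
  if hx : ∃ s, cs.IsRightDescent (δ c x) s then
    X.pick h' (τ x hx.choose) (transport hδ c τ h h' (hδ.gate c hx.choose x)) (h hx.choose x)
  else c
termination_by cs.length (δ c x)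
decreasing_by exact hδ.length_gate_lt hx.choose_spec

theorem transport_self (hδ : X.IsWeylDistance cs δ) (τ : Φ → Equiv.Perm S) (h h' : S → Φ → ℕ) : transport hδ c τ h h' c = c := by
  rw [transport, dif_neg]
  rintro ⟨s, hs⟩
  rw [hδ.self] at hs
  exact cs.not_isRightDescent_one s hs

section Transport

variable (hM : M.IsRightAngled) (hδ : X.IsWeylDistance cs δ) {τ : Φ → Equiv.Perm S}
  {h h' : S → Φ → ℕ} (hτ : X.IsTwist M q τ) (hh : X.IsColoring cs δ c q h)
  (hh' : X.IsColoring cs δ c q h')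

include hM hδ hτ hh hh'

/-- The recursion uses one arbitrary descent; this shows that every descent would give the same
value. It is the only source of information on the map used later, besides the image of `c`. -/
theorem transport_spec (x : Φ) : ∀ s,
    X.Rel (τ x s) (transport hδ c τ h h' x) (transport hδ c τ h h' (hδ.gate c s x)) ∧
      h' (τ x s) (transport hδ c τ h h' x) = h s x := by
  set g := transport hδ c τ h h' with hg
  induction hn : cs.length (δ c x) using Nat.strong_induction_on generalizing x with
  | _ n ih =>
  subst hn
  by_cases hx : ∃ s, cs.IsRightDescent (δ c x) s
  · obtain ⟨s, hs, hgx⟩ : ∃ s, cs.IsRightDescent (δ c x) s ∧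
        g x = X.pick h' (τ x s) (g (hδ.gate c s x)) (h s x) := by
      refine ⟨hx.choose, hx.choose_spec, ?_⟩
      rw [hg, transport, dif_pos hx]
    obtain ⟨hrel, hcol⟩ := hh'.pick_spec (s := τ x s) (x := g (hδ.gate c s x)) (a := h s x)
      (by rw [hτ.param]; exact hh.lt s x)
    rw [← hgx] at hrel hcol
    have hzlt := hδ.length_gate_lt hs
    have hz := hδ.gate_rel (c := c) s x
    have hzs := hδ.gate_not_isRightDescent (c := c) s x
    set z := hδ.gate c s x
    intro t
    by_cases hst : s = t
    · subst hst; exact ⟨hrel.symm, hcol⟩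
    have hne : τ x s ≠ τ x t := fun h => hst ((τ x).injective h)
    rcases hM s t hst with h2 | h0
    · have h2' : M (τ x s) (τ x t) = 2 := by rw [hτ.matrix, h2]
      have hts : M t s = 2 := by rw [M.symmetric, h2]
      have hts' : M (τ x t) (τ x s) = 2 := by rw [M.symmetric, h2']
      have eτs : τ z s = τ x s := hτ.self hz
      have eτt : τ z t = τ x t := hτ.perp hz h2
      have ihz := ih _ hzlt z rfl
      have hc : h' (τ x t) (g x) = h t x := by
        rw [← hh'.const hne.symm hts' hrel, ← eτt, (ihz t).2]
        exact hh.const (Ne.symm hst) hts hz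
      refine ⟨?_, hc⟩
      by_cases ht : cs.IsRightDescent (δ c x) t
      · have hy := hδ.gate_rel (c := c) t x
        have hylt := hδ.length_gate_lt ht
        have hyt := hδ.gate_not_isRightDescent (c := c) t x
        set y := hδ.gate c t x
        have hz' := hδ.gate_rel (c := c) t z
        have hzt' := hδ.gate_not_isRightDescent (c := c) t z
        set z' := hδ.gate c t z
        -- With two descents `s` and `t`, the chambers `x`, `y`, `z`, `z'` form a square whose
        -- corner nearest `c` is `z'`.
        have hgy : hδ.gate c s y = z' := by
          obtain ⟨y', h3, h4⟩ := hδ.exists_square hM (Ne.symm hst) hts hz' hz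
          have hy't : ¬ cs.IsRightDescent (δ c y') t := by
            rwa [hδ.isRightDescent_iff_of_rel hM (Ne.symm hst) hts h3]
          have : y' = y := hδ.gate_unique (h4.trans hy.symm) hy't hyt
          subst this
          refine hδ.gate_eq_of_rel h3 ?_
          rwa [hδ.isRightDescent_iff_of_rel hM hst h2 hz'.symm]
        have ihy := ih _ hylt y rfl s
        have eys : τ y s = τ x s := hτ.perp hy hts
        rw [hgy, eys] at ihy
        have ihzt := (ihz t).1
        rw [eτt] at ihzt
        -- Complete the image square. Its fourth corner lies in the same panel as `g y` and has the
        -- same color, so the two coincide.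
        obtain ⟨y'', h5, h6⟩ := hδ.exists_square hM hne.symm hts' ihzt.symm hrel
        have : y'' = g y := by
          refine hh'.inj (h5.symm.trans ihy.1.symm) ?_
          rw [hh'.const hne h2' h6, hcol, ihy.2]
          exact (hh.const hst h2 hy).symm
        rw [← this]
        exact h6.symm
      · rw [hδ.gate_eq_self ht]
    · have ht : ¬ cs.IsRightDescent (δ c x) t := by
        intro ht
        have := CoxeterSystem.eq_two_of_isRightDescent hM cs hst hs ht
        omega
      refine ⟨by rw [hδ.gate_eq_self ht], ?_⟩
      rw [hh.zero ht]
      -- The image has a nonzero color of type `τ x s`, hence a descent there; a further descent `τ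
      -- x t` would have to commute with it.
      refine hh'.zero fun ht' => ?_
      have hs' : cs.IsRightDescent (δ c (g x)) (τ x s) := by
        by_contra hn
        rw [hh'.zero hn] at hcol
        exact (hh.eq_zero_iff hδ).1 hcol.symm hs
      have := CoxeterSystem.eq_two_of_isRightDescent hM cs hne hs' ht'
      rw [hτ.matrix] at this
      omega
  · have hgx : g x = c := by rw [hg, transport, dif_neg hx]
    push Not at hx
    intro s
    rw [hδ.gate_eq_self (hx s), hh.zero (hx s), hgx]
    refine ⟨Rel.refl X _ _, hh'.zero ?_⟩
    rw [hδ.self]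
    exact cs.not_isRightDescent_one _

theorem transport_rel {s : S} {x y : Φ} (hxy : X.Rel s x y) :
    X.Rel (τ x s) (transport hδ c τ h h' x) (transport hδ c τ h h' y) := by
  have h1 := (transport_spec hM hδ hτ hh hh' x s).1
  have h2 := (transport_spec hM hδ hτ hh hh' y s).1
  rw [← hτ.self hxy] at h2
  rw [hδ.gate_eq_gate hxy] at h1
  exact h1.trans h2.symm

theorem transport_surj_panel {s : S} {x y' : Φ}
    (hy' : X.Rel (τ x s) (transport hδ c τ h h' x) y') :
    ∃ y, X.Rel s x y ∧ transport hδ c τ h h' y = y' := by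
  have ha : h' (τ x s) y' < q s := by rw [← hτ.param x s]; exact hh'.lt _ _
  obtain ⟨y, hy, hyc⟩ := hh.surj x ha
  refine ⟨y, hy, ?_⟩
  have h1 := transport_rel hM hδ hτ hh hh' hy
  refine hh'.inj (h1.symm.trans hy') ?_
  rw [hτ.self hy, (transport_spec hM hδ hτ hh hh' y s).2, hyc, hτ.self hy]

theorem transport_surjective : Function.Surjective (transport hδ c τ h h') := by
  intro y
  refine residue_induction (P := fun y => ∃ x, transport hδ c τ h h' x = y)
    ⟨c, transport_self hδ τ h h'⟩ ?_ (hδ.connected c y)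
  rintro s - _ z hz ⟨x, rfl⟩
  obtain ⟨y, -, hy⟩ := transport_surj_panel hM hδ hτ hh hh' (s := (τ x).symm s) (x := x) (y' := z)
    (by simpa using hz)
  exact ⟨y, hy⟩

theorem isRightDescent_transport_iff (x : Φ) (s : S) :
    cs.IsRightDescent (δ c (transport hδ c τ h h' x)) (τ x s) ↔ cs.IsRightDescent (δ c x) s := by
  have := (transport_spec hM hδ hτ hh hh' x s).2
  rw [← not_iff_not, ← hh'.eq_zero_iff hδ, this, hh.eq_zero_iff hδ]

/-- Descents correspond under the twist, so equal images have matching descents. Their gates then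
have equal images, being the color-`0` chamber of one panel, and induction on the distance from `c`
applies. -/
theorem transport_injective : Function.Injective (transport hδ c τ h h') := by
  suffices H : ∀ x y, transport hδ c τ h h' x = transport hδ c τ h h' y → x = y from fun x y => H x y
  have spec := transport_spec hM hδ hτ hh hh'
  have desc := isRightDescent_transport_iff hM hδ hτ hh hh'
  intro x
  induction hn : cs.length (δ c x) using Nat.strong_induction_on generalizing x with
  | _ n ih =>
  subst hn
  intro y hxy
  by_cases hx : δ c x = 1
  · have hy : δ c y = 1 := by
      by_contra hy
      obtain ⟨t, ht⟩ := cs.exists_rightDescent_of_ne_one hy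
      rw [← desc y t, ← hxy] at ht
      have h1 := desc x ((τ x).symm (τ y t))
      rw [Equiv.apply_symm_apply, hx] at h1
      exact cs.not_isRightDescent_one _ (h1.1 ht)
    exact (hδ.eq_one_iff.1 hx).symm.trans (hδ.eq_one_iff.1 hy)
  · obtain ⟨s, hs⟩ := cs.exists_rightDescent_of_ne_one hx
    obtain ⟨t, ht⟩ := (τ y).surjective (τ x s)
    have hzx := spec x s
    have hzy := spec y t
    have hgate : ∀ u s, h' (τ u s) (transport hδ c τ h h' (hδ.gate c s u)) = 0 := by
      intro u s
      rw [← hτ.self (hδ.gate_rel (c := c) s u), (spec (hδ.gate c s u) s).2]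
      exact hh.zero (hδ.gate_not_isRightDescent s u)
    rw [ht, ← hxy] at hzy
    have hz := hh'.inj (hzx.1.symm.trans hzy.1) (by
      rw [hgate x s]; have := hgate y t; rw [ht] at this; rw [this])
    have hz' := ih _ (hδ.length_gate_lt hs) _ rfl _ hz
    -- The twists at `x` and `y` need not be known to agree; both are compared with the twist at
    -- their common gate.
    have hst : s = t := by
      apply (τ (hδ.gate c s x)).injective
      rw [hτ.self (hδ.gate_rel s x), hz', hτ.self (hδ.gate_rel t y), ht]
    subst hst
    refine hh.inj ((hδ.gate_rel s x).symm.trans (hz' ▸ hδ.gate_rel s y)) ?_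
    rw [← hzx.2, ← hzy.2]

/-- If the twist is trivial and the colorings agree on a ball, then the ball is fixed. -/
theorem transport_eq_self {n : ℕ} (hn : ∀ x, cs.length (δ c x) ≤ n → τ x = 1 ∧ ∀ s, h' s x = h s x)
    (x : Φ) (hx : cs.length (δ c x) ≤ n) : transport hδ c τ h h' x = x := by
  induction hk : cs.length (δ c x) using Nat.strong_induction_on generalizing x with
  | _ k ih =>
  subst hk
  by_cases h1 : δ c x = 1
  · rw [← hδ.eq_one_iff.1 h1]; exact transport_self hδ τ h h'
  · obtain ⟨s, hs⟩ := cs.exists_rightDescent_of_ne_one h1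
    have hlt := hδ.length_gate_lt hs
    have hz := ih _ hlt _ (hlt.le.trans hx) rfl
    have hsp := transport_spec hM hδ hτ hh hh' x s
    rw [hz, (hn x hx).1, Equiv.Perm.one_apply] at hsp
    refine hh'.inj (hsp.1.trans (hδ.gate_rel s x)) ?_
    rw [hsp.2, (hn x hx).2]

end Transport

end ChamberSystem

/-! ### Vertices and the automorphisms induced by twists -/

namespace ChamberSystem

variable {S W Φ : Type*} [Group W] {M : CoxeterMatrix S} {cs : CoxeterSystem M W}
  {X : ChamberSystem S Φ} {δ : Φ → Φ → W} {c : Φ} {q : S → ℕ}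

namespace Vertex

theorem le_iff {v w : X.Vertex cs} : v ≤ w ↔ v.type ⊆ w.type ∧ v.chambers ⊆ w.chambers := Iff.rfl

theorem chambers_nonempty (v : X.Vertex cs) : v.chambers.Nonempty := by
  obtain ⟨x, hx⟩ := v.isResidue
  exact ⟨x, hx ▸ mem_residue_self X _ x⟩

theorem chambers_eq (v : X.Vertex cs) {x : Φ} (hx : x ∈ v.chambers) :
    v.chambers = X.residue v.type x := by
  obtain ⟨y, hy⟩ := v.isResidue
  rw [hy] at hx
  rw [hy, residue_eq_of_mem hx]

theorem ext_of_mem {v w : X.Vertex cs} {x : Φ} (hv : x ∈ v.chambers) (hw : x ∈ w.chambers)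
    (h : v.type = w.type) : v = w :=
  Vertex.ext h (by rw [v.chambers_eq hv, w.chambers_eq hw, h])

/-- Every panel has a second chamber, and an `s`-neighbor inside a `T`-residue forces `s ∈ T`. Thus
the chambers of a vertex determine its type. -/
theorem type_subset (hM : M.IsRightAngled) (hδ : X.IsWeylDistance cs δ)
    (hadj : ∀ s x, ∃ y, X.Adjacent s x y) {v w : X.Vertex cs} (h : v.chambers ⊆ w.chambers) :
    v.type ⊆ w.type := by
  obtain ⟨x, hx⟩ := v.chambers_nonempty
  intro s hs
  obtain ⟨y, hy⟩ := hadj s x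
  refine hδ.mem_of_adjacent_of_mem_residue hM hy ?_
  rw [← w.chambers_eq (h hx)]
  refine h ?_
  rw [v.chambers_eq hx]
  exact Rel.mem_residue hy.1 hs

theorem le_iff_chambers (hM : M.IsRightAngled) (hδ : X.IsWeylDistance cs δ)
    (hadj : ∀ s x, ∃ y, X.Adjacent s x y) {v w : X.Vertex cs} :
    v ≤ w ↔ v.chambers ⊆ w.chambers :=
  ⟨fun h => h.2, fun h => ⟨type_subset hM hδ hadj h, h⟩⟩

theorem ext_chambers (hM : M.IsRightAngled) (hδ : X.IsWeylDistance cs δ)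
    (hadj : ∀ s x, ∃ y, X.Adjacent s x y) {v w : X.Vertex cs} (h : v.chambers = w.chambers) :
    v = w :=
  Vertex.ext (Set.Subset.antisymm (type_subset hM hδ hadj h.subset)
    (type_subset hM hδ hadj h.symm.subset)) h

end Vertex

/-- The vertex of type `T` of the chamber `x`. -/
def vertexAt (X : ChamberSystem S Φ) {T : Set S} (hT : cs.IsSpherical T) (x : Φ) : X.Vertex cs :=
  ⟨T, X.residue T x, hT, x, rfl⟩

theorem mem_vertexAt {T : Set S} (hT : cs.IsSpherical T) (x : Φ) :
    x ∈ (X.vertexAt hT x).chambers := mem_residue_self X T x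

theorem _root_.CoxeterSystem.isSpherical_empty (cs : CoxeterSystem M W) :
    cs.IsSpherical (∅ : Set S) := by
  unfold CoxeterSystem.IsSpherical CoxeterSystem.specialSubgroup
  rw [Set.image_empty, Subgroup.closure_empty]
  infer_instance

section Twist

variable [Finite S] (hM : M.IsRightAngled) {τ : Φ → Equiv.Perm S} (hτ : X.IsTwist M q τ)
include hM hτ

theorem IsTwist.isSpherical_image_iff (x : Φ) {T : Set S} :
    cs.IsSpherical (τ x '' T) ↔ cs.IsSpherical T := by
  rw [CoxeterSystem.isSpherical_iff hM, CoxeterSystem.isSpherical_iff hM]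
  simp only [Set.forall_mem_image, hτ.matrix, ne_eq, (τ x).injective.eq_iff]

/-- All elements of a spherical `T` lie in each other's stars, so crossing panels with types in `T`
cannot change the twist on `T`. -/
theorem IsTwist.eq_of_mem_residue (cs : CoxeterSystem M W) {T : Set S} (hT : cs.IsSpherical T)
    {x y : Φ} (hy : y ∈ X.residue T x) {s : S} (hs : s ∈ T) : τ y s = τ x s := by
  rw [CoxeterSystem.isSpherical_iff hM] at hT
  refine residue_induction (P := fun y => τ y s = τ x s) rfl ?_ hy
  intro t ht y z hyz ih
  rw [← ih]
  by_cases hts : t = s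
  · subst hts; exact (hτ.self hyz).symm
  · exact (hτ.perp hyz (hT t ht s hs hts)).symm

theorem IsTwist.image_residue (cs : CoxeterSystem M W) {g : Φ → Φ}
    (hrel : ∀ {s x y}, X.Rel s x y → X.Rel (τ x s) (g x) (g y))
    (hsurj : ∀ {s x y}, X.Rel (τ x s) (g x) y → ∃ z, X.Rel s x z ∧ g z = y)
    {T : Set S} (hT : cs.IsSpherical T) (x : Φ) :
    g '' X.residue T x = X.residue (τ x '' T) (g x) := by
  ext y
  constructor
  · rintro ⟨y, hy, rfl⟩
    suffices H : y ∈ X.residue T x ∧ g y ∈ X.residue (τ x '' T) (g x) from H.2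
    refine residue_induction
      (P := fun y => y ∈ X.residue T x ∧ g y ∈ X.residue (τ x '' T) (g x))
      ⟨mem_residue_self X _ _, mem_residue_self X _ _⟩ ?_ hy
    rintro s hs y z hyz ⟨ih, ih'⟩
    refine ⟨mem_residue_trans ih (hyz.mem_residue hs), mem_residue_trans ih' ?_⟩
    refine (hrel hyz).mem_residue ?_
    rw [hτ.eq_of_mem_residue hM cs hT ih hs]
    exact ⟨s, hs, rfl⟩
  · intro hy
    refine residue_induction (P := fun y => y ∈ g '' X.residue T x)
      ⟨x, mem_residue_self X _ _, rfl⟩ ?_ hy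
    rintro _ ⟨s, hs, rfl⟩ _ z hz ⟨y, hy, rfl⟩
    rw [← hτ.eq_of_mem_residue hM cs hT hy hs] at hz
    obtain ⟨w, hw, rfl⟩ := hsurj hz
    exact ⟨w, mem_residue_trans hy (hw.mem_residue hs), rfl⟩

/-- A bijection of the chambers that changes types by a twist induces an automorphism. -/
theorem IsTwist.exists_aut (hδ : X.IsWeylDistance cs δ) (hadj : ∀ s x, ∃ y, X.Adjacent s x y)
    {g : Φ → Φ} (hg : g.Bijective) (hrel : ∀ {s x y}, X.Rel s x y → X.Rel (τ x s) (g x) (g y))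
    (hsurj : ∀ {s x y}, X.Rel (τ x s) (g x) y → ∃ z, X.Rel s x z ∧ g z = y) :
    ∃ a : X.Aut cs, ∀ v, ∀ x ∈ v.chambers,
      g x ∈ (a.1 v).chambers ∧ (a.1 v).type = τ x '' v.type := by
  have himg : ∀ v : X.Vertex cs, ∀ x ∈ v.chambers,
      g '' v.chambers = X.residue (τ x '' v.type) (g x) := by
    intro v x hx
    rw [v.chambers_eq hx, hτ.image_residue hM cs hrel hsurj v.isSpherical]
  -- The choice of chamber is immaterial, because the twist is constant on the type along the
  -- residue.
  choose b hb using fun v : X.Vertex cs => v.chambers_nonempty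
  let F : X.Vertex cs → X.Vertex cs := fun v =>
    ⟨τ (b v) '' v.type, g '' v.chambers, (hτ.isSpherical_image_iff hM _).2 v.isSpherical,
      g (b v), himg v _ (hb v)⟩
  have hF : ∀ v, (F v).chambers = g '' v.chambers := fun _ => rfl
  have hFinj : F.Injective := by
    intro v w hvw
    refine Vertex.ext_chambers hM hδ hadj ?_
    have : (F v).chambers = (F w).chambers := by rw [hvw]
    rw [hF, hF] at this
    exact hg.1.image_injective this
  have hFsurj : F.Surjective := by
    intro w
    obtain ⟨y, hy⟩ := w.chambers_nonempty
    obtain ⟨x, rfl⟩ := hg.2 y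
    have hT : τ x '' ((τ x).symm '' w.type) = w.type := by simp [Set.image_image]
    have hs : cs.IsSpherical ((τ x).symm '' w.type) := by
      rw [← hτ.isSpherical_image_iff hM x, hT]; exact w.isSpherical
    refine ⟨X.vertexAt hs x, Vertex.ext_chambers hM hδ hadj ?_⟩
    rw [hF, himg _ x (mem_vertexAt hs x), w.chambers_eq hy]
    change X.residue (τ x '' ((τ x).symm '' w.type)) _ = _
    rw [hT]
  have hmem : ∀ v x, g x ∈ (F v).chambers ↔ x ∈ v.chambers := by
    intro v x
    rw [hF, hg.1.mem_set_image]
  have hcham : ∀ x, F '' X.chamberVertices cs x = X.chamberVertices cs (g x) := by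
    intro x
    ext w
    obtain ⟨v, rfl⟩ := hFsurj w
    rw [hFinj.mem_set_image]
    exact (hmem v x).symm
  refine ⟨⟨Equiv.ofBijective F ⟨hFinj, hFsurj⟩, fun v w => ?_, fun A => ?_⟩, fun v x hx => ⟨?_, ?_⟩⟩
  · change (F v ≤ F w ∨ F w ≤ F v) ↔ _
    simp only [Vertex.le_iff_chambers hM hδ hadj, hF, Set.image_subset_image_iff hg.1]
  · constructor
    · rintro ⟨y, hy⟩
      obtain ⟨x, rfl⟩ := hg.2 y
      refine ⟨x, hFinj.image_injective ?_⟩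
      rw [hcham]; exact hy
    · rintro ⟨x, rfl⟩
      exact ⟨g x, hcham x⟩
  · exact (hmem v x).2 hx
  · change τ (b v) '' v.type = τ x '' v.type
    refine Set.image_congr fun s hs => ?_
    refine hτ.eq_of_mem_residue hM cs v.isSpherical ?_ hs
    rw [← v.chambers_eq hx]
    exact hb v

/-- Two colorings and a twist give an automorphism; it fixes a ball if the twist is trivial and the
colorings agree there, and it is the identity only if they agree everywhere. -/
theorem IsTwist.exists_aut_of_isColoring (hδ : X.IsWeylDistance cs δ)
    (hadj : ∀ s x, ∃ y, X.Adjacent s x y) {h h' : S → Φ → ℕ} (hh : X.IsColoring cs δ c q h)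
    (hh' : X.IsColoring cs δ c q h') :
    ∃ a : X.Aut cs, (∀ v, ∀ x ∈ v.chambers, (a.1 v).type = τ x '' v.type) ∧
      (a = 1 → ∀ x, τ x = 1 ∧ ∀ s, h' s x = h s x) ∧
      (∀ n, (∀ x, cs.length (δ c x) ≤ n → τ x = 1 ∧ ∀ s, h' s x = h s x) →
        ∀ v : X.Vertex cs, ∀ x ∈ v.chambers, cs.length (δ c x) ≤ n → a.1 v = v) := by
  obtain ⟨a, ha⟩ := hτ.exists_aut hM hδ hadj
    ⟨transport_injective hM hδ hτ hh hh', transport_surjective hM hδ hτ hh hh'⟩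
    (fun hxy => transport_rel hM hδ hτ hh hh' hxy)
    (fun hy => transport_surj_panel hM hδ hτ hh hh' hy)
  refine ⟨a, fun v x hx => (ha v x hx).2, ?_, ?_⟩
  · rintro rfl x
    have htr : transport hδ c τ h h' x = x := by
      have := (ha (X.vertexAt cs.isSpherical_empty x) x (mem_vertexAt _ x)).1
      change _ ∈ X.residue ∅ x at this
      rwa [residue_empty] at this
    have hτx : τ x = 1 := by
      ext s
      have := (ha (X.vertexAt (cs.isSpherical_singleton s) x) x (mem_vertexAt _ x)).2
      change {s} = τ x '' {s} at this
      rw [Set.image_singleton, Set.singleton_eq_singleton_iff] at this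
      exact this.symm
    refine ⟨hτx, fun s => ?_⟩
    have := (transport_spec hM hδ hτ hh hh' x s).2
    rwa [htr, hτx] at this
  · intro n hn v x hx hxn
    have h1 := ha v x hx
    rw [transport_eq_self hM hδ hτ hh hh' hn x hxn, (hn x hxn).1] at h1
    exact Vertex.ext_of_mem h1.1 hx (by rw [h1.2]; simp)

end Twist

end ChamberSystem

/-! ### The compact-open topology and finite stabilizers -/

open Topology Filter

namespace ChamberSystem

variable {S W Φ : Type*} [Group W] {M : CoxeterMatrix S} {cs : CoxeterSystem M W}
  {X : ChamberSystem S Φ} {δ : Φ → Φ → W} {q : S → ℕ}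

theorem continuous_coordinate {P : Type*} [PartialOrder P] (v : P) :
    Continuous fun x : OrderRealization P => x.1 v :=
  (continuous_apply v).comp continuous_subtype_val

/-- The point of the realization of a poset given by an element. -/
noncomputable def pointAt {P : Type*} [PartialOrder P] (v : P) : OrderRealization P := by
  classical
  exact ⟨Pi.single v 1, fun w => by by_cases h : w = v <;> simp [h],
    (Set.finite_singleton v).subset Pi.support_single_subset,
    (Set.subsingleton_singleton.anti Pi.support_single_subset).isChain,
    (finsum_eq_single _ v fun w hw => by simp [hw]).trans (by simp)⟩

theorem pointAt_apply_pos_iff {P : Type*} [PartialOrder P] {v w : P} :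
    0 < (pointAt v).1 w ↔ w = v := by
  classical
  unfold pointAt
  by_cases h : w = v <;> simp [h]

theorem continuous_toContinuousMap :
    Continuous (Aut.toContinuousMap : X.Aut cs → C(X.Realization cs, X.Realization cs)) :=
  continuous_induced_dom

/-- Evaluate at the point `v` and read the coordinate at `w`: it depends continuously on `g` and is
positive exactly when `g` maps `v` to `w`. -/
theorem isOpen_setOf_apply_eq (v w : X.Vertex cs) : IsOpen {g : X.Aut cs | g.1 v = w} := by
  have h1 : Continuous fun g : X.Aut cs => (Aut.toContinuousMap g (pointAt v)).1 w :=
    (continuous_coordinate w).comp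
      ((continuous_eval_const _).comp continuous_toContinuousMap)
  convert isOpen_lt continuous_const h1 using 1
  ext g
  change _ ↔ 0 < (pointAt v).1 (g.1.symm w)
  rw [pointAt_apply_pos_iff, Equiv.symm_apply_eq]
  exact eq_comm

theorem isOpen_setOf_forall_apply_eq {F : Set (X.Vertex cs)} (hF : F.Finite) (g₀ : X.Aut cs) :
    IsOpen {g : X.Aut cs | ∀ v ∈ F, g.1 v = g₀.1 v} := by
  simp only [Set.ofPred_forall]
  exact hF.isOpen_biInter fun v _ => isOpen_setOf_apply_eq v _

/-- A group of automorphisms is discrete if the stabilizer of some finite set is trivial. -/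
theorem discreteTopology_of_finite (H : Subgroup (X.Aut cs)) {F : Set (X.Vertex cs)}
    (hF : F.Finite) (h : ∀ g ∈ H, (∀ v ∈ F, g.1 v = v) → g = 1) : DiscreteTopology H := by
  rw [discreteTopology_iff_isOpen_singleton]
  intro g₀
  convert (isOpen_setOf_forall_apply_eq hF g₀.1).preimage (continuous_subtype_val (p := (· ∈ H)))
    using 1
  ext g
  constructor
  · rintro rfl v _; rfl
  · intro hg
    have : g₀.1⁻¹ * g.1 = 1 := by
      refine h _ (mul_mem (inv_mem g₀.2) g.2) fun v hv => ?_
      change g₀.1.1⁻¹ (g.1.1 v) = v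
      rw [hg v hv]
      exact Equiv.symm_apply_apply _ _
    exact Subtype.ext (inv_mul_eq_one.1 this).symm

theorem discreteTopology_aut_of_finite {F : Set (X.Vertex cs)} (hF : F.Finite)
    (h : ∀ g : X.Aut cs, (∀ v ∈ F, g.1 v = v) → g = 1) : DiscreteTopology (X.Aut cs) := by
  have hd := discreteTopology_of_finite ⊤ hF fun g _ => h g
  rw [discreteTopology_iff_isOpen_singleton] at hd ⊢
  intro g
  obtain ⟨U, hU, hU'⟩ := isOpen_induced_iff.1 (hd ⟨g, Subgroup.mem_top g⟩)
  convert hU using 1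
  ext g'
  have := congrArg (fun A => (⟨g', Subgroup.mem_top g'⟩ : (⊤ : Subgroup (X.Aut cs))) ∈ A) hU'
  simp only [Set.mem_preimage, Set.mem_singleton_iff, Subtype.mk.injEq] at this
  exact (iff_of_eq this).symm

section LocallyFinite

variable [Finite S] (hδ : X.IsWeylDistance cs δ) (hq : X.HasParameters q)
include hδ hq

theorem finite_comparable (v : X.Vertex cs) : {w : X.Vertex cs | w ≤ v ∨ v ≤ w}.Finite := by
  rw [Set.ofPred_or]
  refine Set.Finite.union ?_ ?_
  · have hv : v.chambers.Finite := by
      obtain ⟨x, hx⟩ := v.isResidue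
      rw [hx]; exact hδ.finite_residue hq v.isSpherical x
    refine Set.Finite.of_finite_image (f := fun w : X.Vertex cs => (w.type, w.chambers)) ?_ ?_
    · refine ((Set.toFinite (Set.univ : Set (Set S))).prod hv.finite_subsets).subset ?_
      rintro _ ⟨w, hw, rfl⟩
      exact ⟨trivial, hw.2⟩
    · intro w _ w' _ h
      exact Vertex.ext (congrArg Prod.fst h) (congrArg Prod.snd h)
  · refine Set.Finite.of_finite_image (f := fun w : X.Vertex cs => w.type) (Set.toFinite _) ?_
    intro w hw w' hw' h
    obtain ⟨x, hx⟩ := v.chambers_nonempty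
    exact Vertex.ext_of_mem (hw.2 hx) (hw'.2 hx) h

/-- Compact sets lie in finite subcomplexes. -/
theorem exists_finite_of_isCompact {K : Set (X.Realization cs)} (hK : IsCompact K) :
    ∃ F : Set (X.Vertex cs), F.Finite ∧ ∀ x ∈ K, ∀ v, x.1 v ≠ 0 → v ∈ F := by
  -- Open stars cover the realization, and the support of a point in the open star of `v` consists
  -- of the finitely many vertices comparable with `v`.
  obtain ⟨t, ht⟩ := hK.elim_finite_subcover (fun v : X.Vertex cs => {x | 0 < x.1 v})
    (fun v => isOpen_lt continuous_const (continuous_coordinate v)) (by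
      intro x _
      have : ∃ v, x.1 v ≠ 0 := by
        by_contra hn
        push Not at hn
        have h1 := x.2.2.2.2
        rw [finsum_congr hn] at h1
        simp at h1
      obtain ⟨v, hv⟩ := this
      exact Set.mem_iUnion.2 ⟨v, lt_of_le_of_ne (x.2.1 v) hv.symm⟩)
  refine ⟨⋃ v ∈ t, {w | w ≤ v ∨ v ≤ w}, t.finite_toSet.biUnion fun v _ =>
    finite_comparable hδ hq v, fun x hx w hw => ?_⟩
  obtain ⟨v, hv, hxv⟩ := Set.mem_iUnion₂.1 (ht hx)
  refine Set.mem_biUnion hv ?_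
  by_cases hwv : w = v
  · exact .inl hwv.le
  · exact x.2.2.2.1 hw (ne_of_gt hxv) hwv

/-- The filter `l` generated by stabilizers of finite sets converges to the identity: on a compact
set only finitely many vertices matter. -/
theorem exists_finite_of_mem_nhds {U : Set (X.Aut cs)} (hU : U ∈ 𝓝 (1 : X.Aut cs)) :
    ∃ F : Set (X.Vertex cs), F.Finite ∧ ∀ g : X.Aut cs, (∀ v ∈ F, g.1 v = v) → g ∈ U := by
  let l : Filter (X.Aut cs) :=
    { sets := {U | ∃ F : Set (X.Vertex cs), F.Finite ∧
        ∀ g : X.Aut cs, (∀ v ∈ F, g.1 v = v) → g ∈ U}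
      univ_sets := ⟨∅, Set.finite_empty, fun _ _ => trivial⟩
      sets_of_superset := fun ⟨F, hF, h⟩ hle => ⟨F, hF, fun g hg => hle (h g hg)⟩
      inter_sets := fun ⟨F, hF, h⟩ ⟨F', hF', h'⟩ => ⟨F ∪ F', hF.union hF', fun g hg =>
        ⟨h g fun v hv => hg v (.inl hv), h' g fun v hv => hg v (.inr hv)⟩⟩ }
  have key : Tendsto (Aut.toContinuousMap : X.Aut cs → _) l (𝓝 (Aut.toContinuousMap 1)) := by
    rw [ContinuousMap.tendsto_nhds_compactOpen]
    intro K hK V _ hKV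
    obtain ⟨F, hF, hF'⟩ := exists_finite_of_isCompact hδ hq hK
    refine ⟨F, hF, fun g hg x hx => ?_⟩
    have hfix : Aut.toContinuousMap g x = Aut.toContinuousMap (1 : X.Aut cs) x := by
      refine Subtype.ext (funext fun v => ?_)
      change x.1 (g.1.symm v) = x.1 v
      by_cases hv : v ∈ F
      · rw [(Equiv.symm_apply_eq _).2 (hg v hv).symm]
      -- As `g` fixes `F` pointwise, it preserves the complement, where both coordinates vanish.
      · have hv' : g.1.symm v ∉ F := by
          intro hmem
          have := hg _ hmem
          rw [Equiv.apply_symm_apply] at this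
          exact hv (this ▸ hmem)
        rw [not_not.1 (mt (hF' x hx v) hv), not_not.1 (mt (hF' x hx _) hv')]
    rw [hfix]
    exact hKV hx
  have hle : l ≤ 𝓝 (1 : X.Aut cs) := by
    rw [nhds_induced]
    exact map_le_iff_le_comap.1 key
  exact hle hU

/-- A group of automorphisms is not discrete if the stabilizer of every finite set is
nontrivial. -/
theorem not_discreteTopology (H : Subgroup (X.Aut cs))
    (h : ∀ F : Set (X.Vertex cs), F.Finite → ∃ g ∈ H, g ≠ 1 ∧ ∀ v ∈ F, g.1 v = v) :
    ¬ DiscreteTopology H := by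
  intro hd
  have h1 : ({1} : Set H) ∈ 𝓝 (1 : H) := (isOpen_discrete _).mem_nhds rfl
  obtain ⟨U, hU, hU'⟩ := mem_nhds_subtype _ _ _ |>.1 h1
  obtain ⟨F, hF, hF'⟩ := exists_finite_of_mem_nhds hδ hq hU
  obtain ⟨g, hg, hg1, hgF⟩ := h F hF
  have : (⟨g, hg⟩ : H) ∈ ({1} : Set H) := hU' (hF' g hgF)
  exact hg1 (congrArg Subtype.val (Set.mem_singleton_iff.1 this))

end LocallyFinite

end ChamberSystem

/-! ### Stars in the nerve and the local action on types -/

namespace CoxeterSystem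

variable {S W : Type*} [Group W] {M : CoxeterMatrix S} [Finite S]

theorem isSpherical_pair_iff (hM : M.IsRightAngled) (cs : CoxeterSystem M W) {s t : S}
    (hst : s ≠ t) : cs.IsSpherical {s, t} ↔ M s t = 2 := by
  rw [isSpherical_iff hM]
  constructor
  · intro h; exact h s (by simp) t (by simp) hst
  · intro h a ha b hb hab
    rcases ha with rfl | rfl <;> rcases hb with rfl | rfl
    · exact absurd rfl hab
    · exact h
    · rwa [M.symmetric]
    · exact absurd rfl hab

theorem mem_starVertices_iff (hM : M.IsRightAngled) (cs : CoxeterSystem M W) {s t : S} :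
    t ∈ cs.nerve.starVertices s ↔ t = s ∨ M s t = 2 := by
  classical
  constructor
  · rintro ⟨T, hT, hs, ht⟩
    by_cases hst : t = s
    · exact .inl hst
    · exact .inr ((isSpherical_iff hM cs).1 hT.2 s hs t ht (Ne.symm hst))
  · intro h
    by_cases hst : s = t
    · subst hst
      exact ⟨{s}, ⟨Finset.singleton_nonempty s, by
        rw [Finset.coe_singleton]; exact cs.isSpherical_singleton s⟩, by simp, by simp⟩
    · refine ⟨{s, t}, ⟨Finset.insert_nonempty _ _, ?_⟩, by simp, by simp⟩
      rw [Finset.coe_pair, isSpherical_pair_iff hM cs hst]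
      exact h.resolve_left (Ne.symm hst)

theorem isAutomorphism_matrix (hM : M.IsRightAngled) (cs : CoxeterSystem M W)
    {σ : Equiv.Perm S} (hσ : cs.nerve.IsAutomorphism σ) (s t : S) : M (σ s) (σ t) = M s t := by
  classical
  by_cases hst : s = t
  · subst hst; rw [M.diagonal, M.diagonal]
  have hne : σ s ≠ σ t := fun h => hst (σ.injective h)
  have h1 := hσ {s, t}
  have hmem : ∀ {a b : S}, a ≠ b → (({a, b} : Finset S) ∈ cs.nerve.faces ↔ M a b = 2) := by
    intro a b hab
    rw [← isSpherical_pair_iff hM cs hab, ← Finset.coe_pair]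
    exact ⟨fun h => h.2, fun h => ⟨Finset.insert_nonempty _ _, h⟩⟩
  have h2 : ({s, t} : Finset S).map σ.toEmbedding = {σ s, σ t} := by
    simp [Finset.map_insert]
  rw [h2, hmem hne, hmem hst] at h1
  rcases hM s t hst with h | h <;> rcases hM _ _ hne with h' | h' <;> simp_all

end CoxeterSystem

namespace ChamberSystem

variable {S W Φ : Type*} [Group W] {M : CoxeterMatrix S} {cs : CoxeterSystem M W}
  {X : ChamberSystem S Φ} {δ : Φ → Φ → W} {q : S → ℕ}

theorem chamberVertices_injective :
    Function.Injective (X.chamberVertices cs) := by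
  intro x y h
  have : X.vertexAt cs.isSpherical_empty x ∈ X.chamberVertices cs y :=
    h ▸ mem_vertexAt cs.isSpherical_empty x
  change y ∈ X.residue ∅ x at this
  rw [residue_empty] at this
  exact this.symm

/-- An automorphism permutes the chambers. -/
theorem Aut.exists_chamberMap (g : X.Aut cs) :
    ∃ γ : Φ → Φ, γ.Bijective ∧ ∀ v x, γ x ∈ (g.1 v).chambers ↔ x ∈ v.chambers := by
  choose γ hγ using fun x => (g.2.2 (X.chamberVertices cs x)).2 ⟨x, rfl⟩
  refine ⟨γ, ⟨fun x y hxy => ?_, fun y => ?_⟩, fun v x => ?_⟩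
  · refine chamberVertices_injective (cs := cs) (X := X) (g.1.injective.image_injective ?_)
    rw [hγ, hγ, hxy]
  · have h1 : g.1 '' (g.1.symm '' X.chamberVertices cs y) = X.chamberVertices cs y := by
      simp [Set.image_image]
    obtain ⟨x, hx⟩ := (g.2.2 _).1 ⟨y, h1⟩
    refine ⟨x, chamberVertices_injective (cs := cs) (X := X) ?_⟩
    rw [← hγ, ← hx, h1]
  · change g.1 v ∈ X.chamberVertices cs (γ x) ↔ v ∈ X.chamberVertices cs x
    rw [← hγ, g.1.injective.mem_set_image]

theorem vertexAt_le_iff {T : Set S} (hT : cs.IsSpherical T) {v : X.Vertex cs}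
    {x : Φ} (hx : x ∈ v.chambers) : X.vertexAt hT x ≤ v ↔ T ⊆ v.type := by
  refine ⟨fun h => h.1, fun h => Vertex.le_iff.2 ⟨h, ?_⟩⟩
  rw [v.chambers_eq hx]
  exact residue_mono h x

theorem vertexAt_eq {T : Set S} (hT : cs.IsSpherical T) {v : X.Vertex cs}
    {x : Φ} (hx : x ∈ v.chambers) (h : v.type = T) : v = X.vertexAt hT x :=
  Vertex.ext_of_mem hx (mem_vertexAt hT x) h

theorem vertexAt_eq_of_mem {T : Set S} (hT : cs.IsSpherical T) {x y : Φ}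
    (h : y ∈ X.residue T x) : X.vertexAt hT x = X.vertexAt hT y :=
  vertexAt_eq hT h rfl

/-- The local action of an automorphism on types. -/
theorem Aut.exists_twist [Finite S] (hM : M.IsRightAngled) (hδ : X.IsWeylDistance cs δ)
    (hadj : ∀ s x, ∃ y, X.Adjacent s x y) (g : X.Aut cs) :
    ∃ σ : Φ → Equiv.Perm S, (∀ v, ∀ x ∈ v.chambers, (g.1 v).type = σ x '' v.type) ∧
      (∀ x, cs.nerve.IsAutomorphism (σ x)) ∧
      ∀ s x y, X.Rel s x y → ∀ t ∈ cs.nerve.starVertices s, σ x t = σ y t := by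
  obtain ⟨γ, hγ, hmem⟩ := g.exists_chamberMap
  -- Comparability alone would allow the order to be reversed; the chamber bijection shows that
  -- inclusion is preserved.
  have hle : ∀ v w, g.1 v ≤ g.1 w ↔ v ≤ w := by
    intro v w
    rw [Vertex.le_iff_chambers hM hδ hadj, Vertex.le_iff_chambers hM hδ hadj]
    constructor
    · intro h x hx; exact (hmem _ _).1 (h ((hmem _ _).2 hx))
    · intro h y hy
      obtain ⟨x, rfl⟩ := hγ.2 y
      exact (hmem _ _).2 (h ((hmem _ _).1 hy))
  have sing := cs.isSpherical_singleton
  -- The image contains two chambers, so its type has an element `s'`. The preimage of the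
  -- `s'`-panel lies below the given panel and is not a single chamber, hence equals it.
  have hpanel : ∀ x s, ∃ s', g.1 (X.vertexAt (sing s) x) = X.vertexAt (sing s') (γ x) := by
    intro x s
    set v := X.vertexAt (sing s) x with hv
    have hxv : x ∈ v.chambers := mem_vertexAt _ x
    obtain ⟨y, hy⟩ := hadj s x
    have hyv : y ∈ v.chambers := Rel.mem_residue hy.1 rfl
    have hne : (g.1 v).type.Nonempty := by
      rw [Set.nonempty_iff_ne_empty]
      intro h0
      have h1 := (hmem v y).2 hyv
      rw [(g.1 v).chambers_eq ((hmem v x).2 hxv), h0, residue_empty] at h1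
      exact hy.2 (hγ.1 h1).symm
    obtain ⟨s', hs'⟩ := hne
    refine ⟨s', ?_⟩
    obtain ⟨u, hu⟩ := g.1.surjective (X.vertexAt (sing s') (γ x))
    have hxu : x ∈ u.chambers := by
      rw [← hmem, hu]; exact mem_vertexAt _ _
    have huv : u ≤ v := by
      rw [← hle, hu, vertexAt_le_iff _ ((hmem v x).2 hxv)]
      simpa using hs'
    rcases Set.subset_singleton_iff_eq.1 (Vertex.le_iff.1 huv).1 with h0 | h1
    · exfalso
      obtain ⟨z, hz⟩ := hadj s' (γ x)
      obtain ⟨y', rfl⟩ := hγ.2 z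
      have : γ y' ∈ (g.1 u).chambers := by rw [hu]; exact Rel.mem_residue hz.1 rfl
      rw [hmem, u.chambers_eq hxu, h0, residue_empty] at this
      exact hz.2 (by rw [Set.mem_singleton_iff.1 this])
    · rw [← hu, hv, vertexAt_eq (sing s) hxu h1]
  choose σ hσ using hpanel
  have hinj : ∀ x, (σ x).Injective := by
    intro x s t hst
    have h1 := hσ x s
    rw [hst, ← hσ x t] at h1
    have h2 := congrArg Vertex.type (g.1.injective h1)
    exact Set.singleton_eq_singleton_iff.1 h2
  have htype : ∀ v, ∀ x ∈ v.chambers, (g.1 v).type = σ x '' v.type := by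
    intro v x hx
    ext s'
    obtain ⟨s, rfl⟩ := (Finite.injective_iff_surjective.1 (hinj x)) s'
    rw [(hinj x).mem_set_image, ← Set.singleton_subset_iff, ← Set.singleton_subset_iff,
      ← vertexAt_le_iff (sing _) ((hmem v x).2 hx), ← hσ, hle,
      vertexAt_le_iff (sing _) hx]
  refine ⟨fun x => Equiv.ofBijective (σ x) (Finite.injective_iff_bijective.1 (hinj x)),
    fun v x hx => htype v x hx, fun x T => ?_, fun s x y hxy t ht => ?_⟩
  · have himg : ((T.map (Equiv.ofBijective (σ x)
        (Finite.injective_iff_bijective.1 (hinj x))).toEmbedding : Finset S) : Set S)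
        = σ x '' (T : Set S) := by
      rw [Finset.coe_map]; rfl
    change (_ ∧ _) ↔ (_ ∧ _)
    rw [Finset.map_nonempty, himg]
    refine and_congr_right fun _ => ⟨fun h => ?_, fun h => ?_⟩
    · obtain ⟨u, hu⟩ := g.1.surjective (X.vertexAt h (γ x))
      have hxu : x ∈ u.chambers := by
        rw [← hmem, hu]; exact mem_vertexAt _ _
      have h1 := htype u x hxu
      rw [hu] at h1
      have h2 : (T : Set S) = u.type := (hinj x).image_injective h1
      rw [h2]; exact u.isSpherical
    · have := (g.1 (X.vertexAt h x)).isSpherical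
      rwa [htype _ x (mem_vertexAt h x)] at this
  · change σ x t = σ y t
    obtain ⟨T, hT, hsT, htT⟩ := ht
    -- Since `s ∈ T`, both chambers share the vertex of type `T`. The cases `{s}` and `{s, t}` then
    -- determine the image of `t`.
    have key : ∀ {T : Set S} (_ : cs.IsSpherical T), s ∈ T → σ x '' T = σ y '' T := by
      intro T hT hs
      have h1 := htype (X.vertexAt hT x) x (mem_vertexAt hT x)
      rw [vertexAt_eq_of_mem hT (Rel.mem_residue hxy hs)] at h1
      exact h1.symm.trans (htype (X.vertexAt hT y) y (mem_vertexAt hT y))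
    have hs := key (sing s) rfl
    rw [Set.image_singleton, Set.image_singleton, Set.singleton_eq_singleton_iff] at hs
    by_cases hst : t = s
    · rw [hst, hs]
    · have hp : ({s, t} : Set S) ⊆ T := by
        rintro u (rfl | rfl) <;> assumption
      have := key (CoxeterSystem.IsSpherical.mono hT.2 hp) (by simp)
      have hmem : σ x t ∈ σ y '' {s, t} := this ▸ ⟨t, by simp, rfl⟩
      obtain ⟨u, rfl | rfl, hu'⟩ := hmem
      · rw [← hs] at hu'
        exact absurd (hinj x hu').symm hst
      · exact hu'.symm

/-! ### Discreteness -/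

section Discrete

variable (hM : M.IsRightAngled) (hδ : X.IsWeylDistance cs δ)
  (hadj : ∀ s x, ∃ y, X.Adjacent s x y) (hq : X.HasParameters q)
  (hcent : ∀ t, 2 < q t → ∀ s, s ≠ t → M s t = 2)
include hM hδ hq hcent

theorem finite_setOf_mem_residue [Finite S] (x : Φ) :
    {v : X.Vertex cs | ∃ y ∈ X.residue {t | 2 < q t} x, y ∈ v.chambers}.Finite := by
  have hT : cs.IsSpherical {t | 2 < q t} :=
    (CoxeterSystem.isSpherical_iff hM cs).2 fun s _ t ht hst => hcent t ht s hst
  have hcham : ∀ y, (X.chamberVertices cs y).Finite := by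
    intro y
    refine Set.Finite.of_finite_image (f := fun w : X.Vertex cs => w.type) (Set.toFinite _) ?_
    intro w hw w' hw' h
    exact Vertex.ext_of_mem hw hw' h
  refine ((hδ.finite_residue hq hT x).biUnion fun y _ => hcham y).subset ?_
  rintro v ⟨y, hy, hv⟩
  exact Set.mem_biUnion hy hv

/-- If all generators with `q t > 2` are central, then a type-preserving automorphism is determined
by its restriction to a residue. -/
theorem eq_one_of_fixes (x₀ : Φ) (g : X.Aut cs) (hg : g ∈ X.typePreserving cs)
    (hfix : ∀ v : X.Vertex cs, (∃ y ∈ X.residue {t | 2 < q t} x₀, y ∈ v.chambers) → g.1 v = v) :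
    g = 1 := by
  obtain ⟨γ, hγ, hmem⟩ := g.exists_chamberMap
  have htp : ∀ v, (g.1 v).type = v.type := hg
  have hrel : ∀ s x y, X.Rel s x y → X.Rel s (γ x) (γ y) := by
    intro s x y hxy
    have hs := cs.isSpherical_singleton s
    have hx := (hmem (X.vertexAt hs x) x).2 (mem_vertexAt hs x)
    have hy := (hmem (X.vertexAt hs x) y).2 (Rel.mem_residue hxy rfl)
    rw [Vertex.chambers_eq _ hx, htp] at hy
    change γ y ∈ X.residue {s} (γ x) at hy
    rwa [residue_singleton] at hy
  have hid : ∀ x, ∀ y ∈ X.residue {t | 2 < q t} x, γ y = y := by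
    intro x
    refine residue_induction (P := fun x => ∀ y ∈ X.residue {t | 2 < q t} x, γ y = y) ?_ ?_
      (hδ.connected x₀ x)
    · intro y hy
      have he := cs.isSpherical_empty
      have h1 := (hmem (X.vertexAt he y) y).2 (mem_vertexAt he y)
      rw [hfix _ ⟨y, hy, mem_vertexAt he y⟩] at h1
      change γ y ∈ X.residue ∅ y at h1
      rwa [residue_empty] at h1
    · intro s _ x x' hxx' ih y' hy'
      by_cases hs : 2 < q s
      · refine ih y' ?_
        rw [residue_eq_of_mem (hxx'.mem_residue (T := {t | 2 < q t}) hs)]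
        exact hy'
      · have hT : {t | 2 < q t} ⊆ perp M s := by
          intro t ht
          have hne : s ≠ t := by rintro rfl; exact hs ht
          exact ⟨hne, hcent t ht s hne⟩
        obtain ⟨y, hy1, hy2⟩ :=
          hδ.exists_rel_of_mem_residue hM hT (mem_residue_symm hy') hxx'.symm
        have hyx : γ y = y := ih y (mem_residue_symm hy2)
        by_contra hne
        have hyy : y ≠ y' := by rintro rfl; exact hne hyx
        -- If `y'` moved, the `s`-panel of the fixed chamber `y` would contain three chambers,
        -- although `q s ≤ 2`.
        have hsub : ({y, y', γ y'} : Set Φ) ⊆ {z | X.Rel s y z} := by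
          have h3 := hrel s y y' hy1.symm
          rw [hyx] at h3
          rintro z (rfl | rfl | rfl)
          · exact Rel.refl X s _
          · exact hy1.symm
          · exact h3
        have hcard := Set.encard_le_encard hsub
        rw [Set.encard_eq_three.2 ⟨y, y', γ y', hyy, ?_, Ne.symm hne, rfl⟩] at hcard
        · have := hq s y
          rw [show {z | X.Rel s y z}.encard = (q s : ℕ∞) from this] at hcard
          have : (3 : ℕ) ≤ q s := by exact_mod_cast hcard
          omega
        · intro h
          rw [← hyx] at h
          exact hyy (hγ.1 h)
  refine Subtype.ext (Equiv.ext fun v => ?_)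
  obtain ⟨x, hx⟩ := v.chambers_nonempty
  have h1 := (hmem v x).2 hx
  rw [hid x x (mem_residue_self X _ x)] at h1
  exact Vertex.ext_of_mem h1 hx (htp v)

theorem discreteTopology_typePreserving [Finite S] [Nonempty Φ] :
    DiscreteTopology (X.typePreserving cs) := by
  obtain ⟨x₀⟩ := ‹Nonempty Φ›
  exact discreteTopology_of_finite _ (finite_setOf_mem_residue hM hδ hq hcent x₀)
    fun g hg hfix => eq_one_of_fixes hM hδ hq hcent x₀ g hg hfix

include hadj in
theorem discreteTopology_aut [Finite S] [Nonempty Φ] (hrigid : cs.nerve.IsRigid) :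
    DiscreteTopology (X.Aut cs) := by
  obtain ⟨x₀⟩ := ‹Nonempty Φ›
  refine discreteTopology_aut_of_finite (finite_setOf_mem_residue hM hδ hq hcent x₀)
    fun g hfix => eq_one_of_fixes hM hδ hq hcent x₀ g ?_ hfix
  obtain ⟨σ, htype, haut, hstar⟩ := g.exists_twist hM hδ hadj
  have hσ : ∀ x, σ x = 1 := by
    intro x
    refine residue_induction (P := fun x => σ x = 1) ?_ ?_ (hδ.connected x₀ x)
    · ext s
      have hs := cs.isSpherical_singleton s
      have h1 := htype (X.vertexAt hs x₀) x₀ (mem_vertexAt hs x₀)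
      rw [hfix _ ⟨x₀, mem_residue_self X _ _, mem_vertexAt hs x₀⟩] at h1
      change {s} = σ x₀ '' {s} at h1
      rw [Set.image_singleton, Set.singleton_eq_singleton_iff] at h1
      exact h1.symm
    · intro s _ y z hyz hy
      refine hrigid _ (haut z) s fun t ht => ?_
      rw [← hstar s y z hyz t ht, hy, Equiv.Perm.one_apply]
  intro v
  obtain ⟨x, hx⟩ := v.chambers_nonempty
  rw [htype v x hx, hσ x]
  simp

end Discrete

end ChamberSystem

/-! ### Half spaces and nondiscreteness -/

namespace ChamberSystem

variable {S W Φ : Type*} [Group W] {M : CoxeterMatrix S} {cs : CoxeterSystem M W}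
  {X : ChamberSystem S Φ} {δ : Φ → Φ → W} {q : S → ℕ}

/-- The position of the chamber `x` in the retraction of `X` onto the line on which the infinite
dihedral group generated by `a` and `b` acts. -/
noncomputable def position (hM : M.IsRightAngled) (cs : CoxeterSystem M W) (δ : Φ → Φ → W) (c : Φ)
    {a b : S} (hab : M a b = 0) (x : Φ) : ℤ :=
  CoxeterSystem.dihedralHom hM cs hab (δ c x)⁻¹ 0

section Position

variable (hM : M.IsRightAngled) {a b : S} (hab : M a b = 0) (c : Φ)

theorem position_le (x : Φ) : position hM cs δ c hab x ≤ cs.length (δ c x) := by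
  rw [← cs.length_inv]
  exact (le_abs_self _).trans (CoxeterSystem.abs_dihedralHom_le hM cs hab _)

theorem position_of_rel (hδ : X.IsWeylDistance cs δ) {u : S} {x y : Φ} (h : X.Rel u x y) :
    position hM cs δ c hab y = position hM cs δ c hab x ∨
      position hM cs δ c hab y =
        CoxeterSystem.dihedralFun a b u (position hM cs δ c hab x) := by
  unfold position
  rcases hδ.eq_or_eq_mul_simple c h with h | h <;> rw [h]
  · exact .inl rfl
  · right
    -- The inverse in the definition makes a step at the far end of a gallery act last on the
    -- position.
    rw [mul_inv_rev, cs.inv_simple, map_mul, Equiv.Perm.mul_apply,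
      CoxeterSystem.dihedralHom_simple, CoxeterSystem.dihedralStep_apply]

theorem exists_position_eq (hδ : X.IsWeylDistance cs δ) (hadj : ∀ s x, ∃ y, X.Adjacent s x y)
    (k : ℕ) : ∃ x, position hM cs δ c hab x = k := by
  obtain ⟨x, hx⟩ := hδ.exists_eq hadj c
    (cs.wordProd (CoxeterSystem.alternatingWord b a k))⁻¹
  refine ⟨x, ?_⟩
  rw [position, hx, inv_inv, CoxeterSystem.dihedralHom_alternatingWord]

/-- A half space bounded by panels of type `a`. -/
theorem odd_le_position_iff_of_rel (hδ : X.IsWeylDistance cs δ) (n : ℤ) {u : S} (hu : u ≠ a)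
    {x y : Φ} (h : X.Rel u x y) :
    2 * n + 1 ≤ position hM cs δ c hab y ↔ 2 * n + 1 ≤ position hM cs δ c hab x := by
  rcases position_of_rel hM hab c hδ h with h | h <;> rw [h]
  simp only [CoxeterSystem.dihedralFun, hu, if_false]
  split_ifs with _ h2
  · obtain ⟨k, hk⟩ := h2; omega
  · obtain ⟨k, hk⟩ := Int.not_even_iff_odd.1 h2; omega
  · rfl

/-- A half space bounded by panels of type `b`. -/
theorem even_le_position_iff_of_rel (hδ : X.IsWeylDistance cs δ) (n : ℤ) {u : S} (hu : u ≠ b)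
    {x y : Φ} (h : X.Rel u x y) :
    2 * n ≤ position hM cs δ c hab y ↔ 2 * n ≤ position hM cs δ c hab x := by
  rcases position_of_rel hM hab c hδ h with h | h <;> rw [h]
  simp only [CoxeterSystem.dihedralFun, hu, if_false]
  split_ifs with _ h2
  · obtain ⟨k, hk⟩ := h2; omega
  · obtain ⟨k, hk⟩ := Int.not_even_iff_odd.1 h2; omega
  · rfl

end Position

open Classical in
/-- Permuting two nonzero colors of type `s` on a set of chambers bounded by panels of types that
do not commute with `s`. -/
theorem IsColoring.recolor {c : Φ} {h : S → Φ → ℕ} (hh : X.IsColoring cs δ c q h) {s : S}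
    (hs : 2 < q s) {C : Φ → Prop}
    (hC : ∀ {u x y}, u = s ∨ M s u = 2 → X.Rel u x y → (C x ↔ C y)) :
    X.IsColoring cs δ c q
      (fun u x => if u = s ∧ C x then Equiv.swap 1 2 (h u x) else h u x) := by
  have hsw : ∀ a, a < q s → Equiv.swap 1 2 a < q s := by
    intro a ha
    rw [Equiv.swap_apply_def]; split_ifs <;> omega
  refine ⟨fun u x => ?_, fun {u x y} hxy he => ?_, fun {u} x {a} ha => ?_,
    fun {u t x y} hut h2 hxy => ?_, fun {u x} hd => ?_⟩
  · split_ifs with hu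
    · rw [hu.1]; exact hsw _ (hh.lt s x)
    · exact hh.lt u x
  · refine hh.inj hxy ?_
    by_cases hu : u = s
    · subst hu
      simp only [true_and, hC (.inl rfl) hxy] at he
      split_ifs at he
      · exact (Equiv.injective _) he
      · exact he
    · simpa [hu] using he
  · by_cases hu : u = s ∧ C x
    · obtain ⟨rfl, hx⟩ := hu
      obtain ⟨y, hy, hya⟩ := hh.surj x (hsw a ha)
      refine ⟨y, hy, ?_⟩
      rw [if_pos ⟨rfl, (hC (.inl rfl) hy).1 hx⟩, hya, Equiv.swap_apply_self]
    · obtain ⟨y, hy, hya⟩ := hh.surj x ha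
      refine ⟨y, hy, ?_⟩
      rw [if_neg, hya]
      rintro ⟨rfl, hCy⟩
      exact hu ⟨rfl, (hC (.inl rfl) hy).2 hCy⟩
  · change (if _ then _ else _) = (if _ then _ else _)
    rw [hh.const hut h2 hxy]
    by_cases hu : u = s
    · subst hu
      simp only [true_and, hC (.inr h2) hxy]
    · simp [hu]
  · change (if _ then _ else _) = _
    rw [hh.zero hd, Equiv.swap_apply_of_ne_of_ne (by norm_num) (by norm_num), ite_self]

theorem exists_length_bound (c : Φ) {F : Set (X.Vertex cs)} (hF : F.Finite) :
    ∃ n, ∀ v ∈ F, ∃ x ∈ v.chambers, cs.length (δ c x) ≤ n := by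
  choose b hb using fun v : X.Vertex cs => v.chambers_nonempty
  obtain ⟨n, hn⟩ := (hF.image fun v => cs.length (δ c (b v))).bddAbove
  exact ⟨n, fun v hv => ⟨b v, hb v, hn ⟨v, hv, rfl⟩⟩⟩

theorem isTwist_one (X : ChamberSystem S Φ) (M : CoxeterMatrix S) (q : S → ℕ) :
    X.IsTwist M q 1 :=
  ⟨fun _ _ _ => rfl, fun _ _ => rfl, fun _ => rfl, fun _ _ _ => rfl⟩

variable [Finite S] (hM : M.IsRightAngled) (hδ : X.IsWeylDistance cs δ)
  (hadj : ∀ s x, ∃ y, X.Adjacent s x y) (hq : X.HasParameters q)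
include hM hδ hadj hq

theorem not_discreteTopology_typePreserving [Nonempty Φ] {s t : S} (hs : 2 < q s)
    (hst : M s t = 0) : ¬ DiscreteTopology (X.typePreserving cs) := by
  classical
  obtain ⟨c⟩ := ‹Nonempty Φ›
  refine not_discreteTopology hδ hq _ fun F hF => ?_
  obtain ⟨n, hn⟩ := exists_length_bound (δ := δ) c hF
  obtain ⟨h, hh⟩ := exists_isColoring hM hδ hq c
  set p := position hM cs δ c hst with hp
  -- Position is bounded by the distance from `c`, so `2 * N > n` keeps the recolored half space off
  -- the ball of radius `n`. Its walls have type `t`, which differs from `s` and does not commute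
  -- with it.
  set N : ℤ := n + 1 with hN
  have hh' := hh.recolor hs (C := fun x => 2 * N ≤ p x) (by
    intro u x y hu hxy
    refine (even_le_position_iff_of_rel hM hst c hδ N ?_ hxy).symm
    rintro rfl
    rcases hu with rfl | hu
    · simp at hst
    · omega)
  obtain ⟨a, ha1, ha2, ha3⟩ := (isTwist_one X M q).exists_aut_of_isColoring hM hδ hadj hh hh'
  refine ⟨a, fun v => ?_, fun h1 => ?_, fun v hv => ?_⟩
  · obtain ⟨x, hx⟩ := v.chambers_nonempty
    rw [ha1 v x hx]
    simp
  · obtain ⟨x, hx⟩ := exists_position_eq hM hst c hδ hadj (2 * (n + 1))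
    -- The panel lies wholly beyond the wall; its chamber of color `1` is recolored `2`, so the
    -- automorphism is not the identity.
    obtain ⟨y, hy, hy1⟩ := hh.surj (s := s) x (a := 1) (by omega)
    have hst' : s ≠ t := by rintro rfl; simp at hst
    have hC : 2 * N ≤ p y := by
      rw [even_le_position_iff_of_rel hM hst c hδ N hst' hy, hx, hN]
      push_cast; exact le_rfl
    have := (ha2 h1 y).2 s
    rw [if_pos ⟨rfl, hC⟩, hy1, Equiv.swap_apply_left] at this
    omega
  · obtain ⟨x, hx, hxn⟩ := hn v hv
    refine ha3 n (fun x hx => ⟨rfl, fun u => if_neg ?_⟩) v x hx hxn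
    rintro ⟨-, hC⟩
    have : p x ≤ _ := position_le (δ := δ) (cs := cs) hM hst c x
    omega

theorem not_discreteTopology_aut_of_isFlexible [Nonempty Φ]
    (hcent : ∀ t, 2 < q t → ∀ s, s ≠ t → M s t = 2) (hflex : cs.nerve.IsFlexible) :
    ¬ DiscreteTopology (X.Aut cs) := by
  classical
  obtain ⟨c⟩ := ‹Nonempty Φ›
  unfold AbstractSimplicialComplex.IsFlexible AbstractSimplicialComplex.IsRigid at hflex
  push Not at hflex
  obtain ⟨σ, hσ, a, hfix, hne⟩ := hflex
  simp only [CoxeterSystem.mem_starVertices_iff hM] at hfix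
  obtain ⟨b, hab⟩ : ∃ b, M a b = 0 := by
    by_contra hcon
    push Not at hcon
    refine hne (Equiv.ext fun s => hfix s ?_)
    by_cases hs : s = a
    · exact .inl hs
    · exact .inr ((hM a s (Ne.symm hs)).resolve_right (hcon s))
  -- A generator with `q s > 2` is central, so it lies in the star of `a` and is fixed; all others
  -- have parameter exactly `2`.
  have hparam : ∀ s, q (σ s) = q s := by
    have hbig : ∀ s, 2 < q s → σ s = s := by
      intro s hs
      refine hfix s ?_
      by_cases hsa : s = a
      · exact .inl hsa
      · exact .inr (hcent s hs a (Ne.symm hsa))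
    have hge : ∀ s, 2 ≤ q s := by
      intro s
      obtain ⟨y, hy⟩ := hadj s c
      have hsub : ({c, y} : Set Φ) ⊆ {z | X.Rel s c z} := by
        rintro z (rfl | rfl)
        · exact Rel.refl X s _
        · exact hy.1
      have hcard := Set.encard_le_encard hsub
      rw [Set.encard_pair hy.2, show {z | X.Rel s c z}.encard = (q s : ℕ∞) from hq s c] at hcard
      exact_mod_cast hcard
    intro s
    by_cases hs : 2 < q s
    · rw [hbig s hs]
    · by_cases hs' : 2 < q (σ s)
      · rw [σ.injective (hbig _ hs')]
      · have := hge s; have := hge (σ s); omega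
  intro hdisc
  refine not_discreteTopology hδ hq (⊤ : Subgroup (X.Aut cs)) (fun F hF => ?_) inferInstance
  obtain ⟨n, hn⟩ := exists_length_bound (δ := δ) c hF
  obtain ⟨h, hh⟩ := exists_isColoring hM hδ hq c
  set p := position hM cs δ c hab with hp
  -- An odd threshold can be crossed only by `a`-panels, and there `σ` agrees with `1` on the star
  -- of `a`. It exceeds `n`, so the twist is trivial on the ball.
  set τ : Φ → Equiv.Perm S := fun x => if 2 * (n : ℤ) + 1 ≤ p x then σ else 1 with hτdef
  have hstar : ∀ {u x y}, X.Rel u x y → ∀ t, t = u ∨ M u t = 2 → τ x t = τ y t := by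
    intro u x y hxy t ht
    by_cases hu : u = a
    · subst hu
      have := hfix t ht
      simp only [hτdef]
      split_ifs <;> simp [this]
    · simp only [hτdef, hp, odd_le_position_iff_of_rel hM hab c hδ n hu hxy]
  have hτ : X.IsTwist M q τ := by
    refine ⟨fun x s t => ?_, fun x s => ?_, fun {s x y} hxy => hstar hxy s (.inl rfl),
      fun {s x y} hxy t ht => hstar hxy t (.inr ht)⟩
    · simp only [hτdef]
      split_ifs
      · exact CoxeterSystem.isAutomorphism_matrix hM cs hσ s t
      · rfl
    · simp only [hτdef]
      split_ifs
      · exact hparam s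
      · rfl
  obtain ⟨g, -, hg2, hg3⟩ := hτ.exists_aut_of_isColoring hM hδ hadj hh hh
  refine ⟨g, Subgroup.mem_top g, fun h1 => ?_, fun v hv => ?_⟩
  · obtain ⟨x, hx⟩ := exists_position_eq hM hab c hδ hadj (2 * n + 1)
    have := (hg2 h1 x).1
    simp only [hτdef, hp, hx] at this
    rw [if_pos (by push_cast; exact le_rfl)] at this
    exact hne this
  · obtain ⟨x, hx, hxn⟩ := hn v hv
    refine hg3 n (fun x hx => ⟨if_neg ?_, fun _ => rfl⟩) v x hx hxn
    have : p x ≤ _ := position_le (δ := δ) (cs := cs) hM hab c x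
    omega

end ChamberSystem

/-! ### Conclusion -/

theorem theoremt {S W Φ : Type*} [Finite S] [Group W] [Infinite W] [Nonempty Φ]
    {M : CoxeterMatrix S} (hM : M.IsRightAngled) (cs : CoxeterSystem M W)
    (X : ChamberSystem S Φ) (hX : X.IsBuilding cs)
    (q : S → ℕ) (hq : X.HasParameters q) :
    ((∃ s t, 2 < q s ∧ M s t = 0) →
      ¬ DiscreteTopology (X.typePreserving cs) ∧ ¬ DiscreteTopology (X.Aut cs)) ∧
    ((∀ s, q s = 2) →
      DiscreteTopology (X.typePreserving cs) ∧
        (¬ DiscreteTopology (X.Aut cs) ↔ cs.nerve.IsFlexible)) ∧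
    (((∃ t, 2 < q t) ∧ ∀ t, 2 < q t → ∀ s, s ≠ t → M s t = 2) →
      DiscreteTopology (X.typePreserving cs) ∧
        (¬ DiscreteTopology (X.Aut cs) ↔ cs.nerve.IsFlexible)) := by
  obtain ⟨hadj, δ, hδ⟩ := hX
  replace hδ : X.IsWeylDistance cs δ := hδ
  -- This covers the last two cases at once: when all parameters equal `2`, the centrality condition
  -- is vacuous.
  have central : (∀ t, 2 < q t → ∀ s, s ≠ t → M s t = 2) →
      DiscreteTopology (X.typePreserving cs) ∧
        (¬ DiscreteTopology (X.Aut cs) ↔ cs.nerve.IsFlexible) := by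
    intro hcent
    refine ⟨ChamberSystem.discreteTopology_typePreserving hM hδ hq hcent, fun h hr => h ?_, ?_⟩
    · exact ChamberSystem.discreteTopology_aut hM hδ hadj hq hcent hr
    · exact ChamberSystem.not_discreteTopology_aut_of_isFlexible hM hδ hadj hq hcent
  refine ⟨?_, fun h2 => central fun t ht => ?_, fun h => central h.2⟩
  · rintro ⟨s, t, hs, hst⟩
    have h0 := ChamberSystem.not_discreteTopology_typePreserving hM hδ hadj hq hs hst
    exact ⟨h0, fun _ => h0 inferInstance⟩
  · rw [h2 t] at ht
    omega
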